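/- All vocabularies are purely relational, and models have nonempty (finite or infinite) domains. For a model $\mathfrak{A}$ and a nonempty finite set $S$ with $S\cap A=\emptyset$, let $\mathfrak{A}+S$ be the model with domain $A\cup S$ in which every relation symbol is interpreted as in $\mathfrak{A}$. A sentence of $\mathcal{L}_{RE}$ over a vocabulary $\tau$ is an expression $\mathrm{I}Y\,\exists X_1\cdots\exists X_k\,\theta$, where $Y\notin\tau$ is a unary relation variable, $X_1,\dots,X_k\notin\tau\cup\{Y\}$ are relation variables and $\theta$ is a first-order sentence over $\tau\cup\{Y,X_1,\dots,X_k\}$. It is true in a $\tau$-model $\mathfrak{A}$ iff there is a nonempty finite set $S$ disjoint from $A$ such that the expansion of $\mathfrak{A}+S$ by $Y\mapsto S$ satisfies the existential second-order sentence $\exists X_1\cdots\exists X_k\,\theta$. The formulas of $\mathrm{D}^*$ over $\tau$ are built from the literals $x=y$, $\neg x=y$, $R(\bar x)$, $\neg R(\bar x)$ with $R\in\tau$, dependence atoms $=\!(x_1,\dots,x_k)$, independence atoms $\bar x\,\bot\,\bar y$ and $\bar x\,\bot_{\bar z}\,\bar y$, inclusion atoms $\bar x\subseteq\bar y$ and exclusion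 atoms $\bar x\mid\bar y$ (for inclusion and exclusion the tuples $\bar x,\bar y$ have equal length; all tuples in dependence, independence, inclusion and exclusion atoms have positive length), by means of $\wedge$, $\vee$, $\forall x$, $\exists x$ and $\mathrm{I}x$. A team $U$ is a set of assignments $s\colon X\to A$ with a common finite domain $X$ of variables, and $\mathrm{Rel}(U,\bar x)=\{s(\bar x) : s\in U\}$. Satisfaction $\mathfrak{A},U\models\varphi$ is lax team semantics: - a literal holds iff every $s\in U$ satisfies it; - $=\!(x_1,\dots,x_k)$ holds iff any $s,s'\in U$ that agree on $x_1,\dots,x_{k-1}$ agree on $x_k$; - $\bar x\,\bot_{\bar z}\,\bar y$ holds iff for all $s,s'\in U$ with $s(\bar z)=s'(\bar z)$ there is $t\in U$ with $t(\bar x)=s(\bar x)$, $t(\bar z)=s(\bar z)$, $t(\bar y)=s'(\bar y)$, and $\bar x\,\bot\,\bar y$ is the same condition without $\bar z$; - $\bar x\subseteq\bar y$ holds iff $\mathrm{Rel}(U,\bar x)\subseteq\mathrm{Rel}(U,\bar y)$, and $\bar x\mid\bar y$ holds iff $\mathrm{Rel}(U,\bar x)\cap\mathrm{Rel}(U,\bar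 y)=\emptyset$; - $\varphi\wedge\psi$ holds iff both conjuncts hold, and $\varphi\vee\psi$ holds iff $U=U_0\cup U_1$ with $\mathfrak{A},U_0\models\varphi$ and $\mathfrak{A},U_1\models\psi$; - $\forall x\,\varphi$ holds iff $\mathfrak{A},\{s[a/x] : s\in U,\ a\in A\}\models\varphi$; - $\exists x\,\varphi$ holds iff there is $f\colon U\to\mathcal{P}(A)\setminus\{\emptyset\}$ with $\mathfrak{A},\{s[a/x] : s\in U,\ a\in f(s)\}\models\varphi$; - $\mathrm{I}x\,\varphi$ holds iff there is a nonempty finite set $S$ disjoint from $A$ with $\mathfrak{A}+S,\{s[a/x] : s\in U,\ a\in S\}\models\varphi$. A sentence of $\mathrm{D}^*$ is a formula without free variables (each of $\forall x$, $\exists x$, $\mathrm{I}x$ binds $x$); it is true in $\mathfrak{A}$ iff it is satisfied by the team $\{\emptyset\}$ that consists of the empty assignment. **Theorem** ($\mathcal{L}_{RE}$ is contained in $\mathrm{D}^*$). For every vocabulary $\tau$ and every $\mathcal{L}_{RE}$-sentence $\varphi$ over $\tau$ there is a $\mathrm{D}^*$-sentence $\psi$ over $\tau$ such that for every $\tau$-model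 $\mathfrak{A}$: $\mathfrak{A}\models\varphi$ if and only if $\mathfrak{A}\models\psi$. -/

import Mathlib

universe u v w

namespace TeamLogic


/-! ### Assignments and teams -/

/-- The countably infinite set of first-order variable symbols. -/
abbrev Var : Type := ℕ

/-- A partial function from variables to `A`; the domain is the set of variables with a value
`some a`. Starting from the empty assignment and updating one variable at a time, only assignments
with a finite domain arise, and all members of a team have the same domain. -/
abbrev Assignment (A : Type w) : Type w := Var → Option A

/-- The empty assignment. -/
def Assignment.empty {A : Type w} : Assignment A := fun _ => none

/-- `s[a/x]`. -/
def Assignment.set {A : Type w} (s : Assignment A) (x : Var) (a : A) : Assignment A :=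
  Function.update s x (some a)

/-- An assignment with codomain `A`, regarded as an assignment with a larger codomain `B`. -/
def Assignment.map {A B : Type w} (e : A → B) (s : Assignment A) : Assignment B :=
  fun x => (s x).map e

abbrev Team (A : Type w) : Type w := Set (Assignment A)

/-- `U[f/x]`, the union over `s ∈ U` of the sets `{s[a/x] | a ∈ f s}`. -/
def Team.supplement {A : Type w} (U : Team A) (x : Var) (f : Assignment A → Set A) : Team A :=
  {t | ∃ s ∈ U, ∃ a ∈ f s, t = s.set x a}

/-- `U[T/x]`. -/
def Team.duplicate {A : Type w} (U : Team A) (x : Var) (T : Set A) : Team A :=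
  {t | ∃ s ∈ U, ∃ a ∈ T, t = s.set x a}

/-- `Rel(U, (x₁, …, xₖ))`. -/
def Team.rel {A : Type w} (U : Team A) {k : ℕ} (x : Fin k → Var) : Set (Fin k → A) :=
  {a | ∃ s ∈ U, ∀ i, s (x i) = some (a i)}

/-! ### Finite bloatings of a model -/

/-- The domain `A ∪ S` with `S` disjoint from `A`. -/
def Bloat (A : Type w) (S : Type) : Type w := A ⊕ S

/-- The elements of the original domain. -/
def Bloat.old {A : Type w} {S : Type} (a : A) : Bloat A S := Sum.inl a

/-- The fresh elements. -/
def Bloat.new {A : Type w} {S : Type} (b : S) : Bloat A S := Sum.inr b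

/-- The set of fresh elements. -/
def Bloat.fresh (A : Type w) (S : Type) : Set (Bloat A S) := Set.range Bloat.new

/-- The model `𝔄 + S`: every relation symbol keeps its interpretation. -/
instance Bloat.structure (L : FirstOrder.Language.{u, v}) [L.IsRelational] (A : Type w) [L.Structure A]
    (S : Type) : L.Structure (Bloat A S) where
  funMap := fun f _ => isEmptyElim f
  RelMap := fun R b => ∃ a, FirstOrder.Language.Structure.RelMap R a ∧ b = fun i => Bloat.old (a i)

/-! ### The logic `D*` -/

/-- Formulas of `D*`, in negation normal form. Tuples of length `k + 1` are the tuples of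
positive length. -/
inductive DStarFormula (L : FirstOrder.Language.{u, v}) : Type v
  | eq (x y : Var) : DStarFormula L
  | neq (x y : Var) : DStarFormula L
  | rel {k : ℕ} (R : L.Relations k) (x : Fin k → Var) : DStarFormula L
  | nrel {k : ℕ} (R : L.Relations k) (x : Fin k → Var) : DStarFormula L
  /-- The dependence atom `=(x₁, …, xₖ, y)`, with `k ≥ 0`. -/
  | dep {k : ℕ} (x : Fin k → Var) (y : Var) : DStarFormula L
  /-- The independence atom `x₁, …, xₖ ⊥ y₁, …, yₙ`. -/
  | indep {k n : ℕ} (x : Fin (k + 1) → Var) (y : Fin (n + 1) → Var) : DStarFormula L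
  /-- The conditional independence atom `x₁, …, xₖ ⊥_{z₁, …, zₘ} y₁, …, yₙ`. -/
  | condIndep {k m n : ℕ} (x : Fin (k + 1) → Var) (z : Fin (m + 1) → Var)
      (y : Fin (n + 1) → Var) : DStarFormula L
  /-- The inclusion atom `x₁, …, xₖ ⊆ y₁, …, yₖ`. -/
  | incl {k : ℕ} (x y : Fin (k + 1) → Var) : DStarFormula L
  /-- The exclusion atom `x₁, …, xₖ | y₁, …, yₖ`. -/
  | excl {k : ℕ} (x y : Fin (k + 1) → Var) : DStarFormula L
  | and (φ ψ : DStarFormula L) : DStarFormula L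
  | or (φ ψ : DStarFormula L) : DStarFormula L
  | all (x : Var) (φ : DStarFormula L) : DStarFormula L
  | ex (x : Var) (φ : DStarFormula L) : DStarFormula L
  /-- The domain-bloating operator `Ix φ`. -/
  | bloat (x : Var) (φ : DStarFormula L) : DStarFormula L

namespace DStarFormula

variable {L : FirstOrder.Language.{u, v}}

/-- The set of free variables. -/
def freeVars : DStarFormula L → Set Var
  | eq x y => {x, y}
  | neq x y => {x, y}
  | rel _ x => Set.range x
  | nrel _ x => Set.range x
  | dep x y => insert y (Set.range x)
  | indep x y => Set.range x ∪ Set.range y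
  | condIndep x z y => Set.range x ∪ Set.range z ∪ Set.range y
  | incl x y => Set.range x ∪ Set.range y
  | excl x y => Set.range x ∪ Set.range y
  | and φ ψ => φ.freeVars ∪ ψ.freeVars
  | or φ ψ => φ.freeVars ∪ ψ.freeVars
  | all x φ => φ.freeVars \ {x}
  | ex x φ => φ.freeVars \ {x}
  | bloat x φ => φ.freeVars \ {x}

/-- Lax team semantics: `φ.Sat A U` is `𝔄, U ⊨ φ`. It is meant for teams whose domain contains
the free variables of `φ`. -/
def Sat [L.IsRelational] :
    DStarFormula L → (A : Type w) → [L.Structure A] → Team A → Prop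
  | eq x y, _, _, U => ∀ s ∈ U, s x = s y
  | neq x y, _, _, U => ∀ s ∈ U, s x ≠ s y
  | rel R x, A, _, U =>
      ∀ s ∈ U, ∃ a : Fin _ → A, (∀ i, s (x i) = some (a i)) ∧ FirstOrder.Language.Structure.RelMap R a
  | nrel R x, A, _, U =>
      ∀ s ∈ U, ∃ a : Fin _ → A, (∀ i, s (x i) = some (a i)) ∧ ¬ FirstOrder.Language.Structure.RelMap R a
  | dep x y, _, _, U => ∀ s ∈ U, ∀ s' ∈ U, (∀ i, s (x i) = s' (x i)) → s y = s' y
  | indep x y, _, _, U =>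
      ∀ s ∈ U, ∀ s' ∈ U, ∃ t ∈ U, (∀ i, t (x i) = s (x i)) ∧ (∀ i, t (y i) = s' (y i))
  | condIndep x z y, _, _, U =>
      ∀ s ∈ U, ∀ s' ∈ U, ∃ t ∈ U, (∀ i, s (z i) = s' (z i)) →
        (∀ i, t (x i) = s (x i)) ∧ (∀ i, t (z i) = s (z i)) ∧ (∀ i, t (y i) = s' (y i))
  | incl x y, _, _, U => U.rel x ⊆ U.rel y
  | excl x y, _, _, U => U.rel x ∩ U.rel y = ∅
  | and φ ψ, A, _, U => φ.Sat A U ∧ ψ.Sat A U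
  | or φ ψ, A, _, U => ∃ U₀ U₁ : Team A, U₀ ∪ U₁ = U ∧ φ.Sat A U₀ ∧ ψ.Sat A U₁
  | all x φ, A, _, U => φ.Sat A (U.duplicate x Set.univ)
  | ex x φ, A, _, U =>
      ∃ f : Assignment A → Set A, (∀ s ∈ U, (f s).Nonempty) ∧ φ.Sat A (U.supplement x f)
  | bloat x φ, A, _, U =>
      ∃ S : Type, Finite S ∧ Nonempty S ∧
        φ.Sat (Bloat A S)
          (Team.duplicate (Assignment.map Bloat.old '' U) x (Bloat.fresh A S))

end DStarFormula

/-- Sentences of `D*`. -/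
def DStarSentence (L : FirstOrder.Language.{u, v}) : Type v := {φ : DStarFormula L // φ.freeVars = ∅}

/-- Truth of a `D*`-sentence in a model: satisfaction by the team `{∅}`. -/
def DStarSentence.Realize {L : FirstOrder.Language.{u, v}} [L.IsRelational] (φ : DStarSentence L)
    (A : Type w) [L.Structure A] : Prop :=
  φ.1.Sat A {Assignment.empty}

/-! ### Existential second-order logic -/

/-- The vocabulary of the relation variables `X₁, …, Xₖ`, with given arities. -/
def relVars {k : ℕ} (arity : Fin k → ℕ) : FirstOrder.Language.{0, 0} where
  Functions := fun _ => Empty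
  Relations := fun n => {i : Fin k // arity i = n}

/-- The interpretation of the relation variables by given relations. -/
abbrev relVars.structure {k : ℕ} {arity : Fin k → ℕ} {A : Type w}
    (X : (i : Fin k) → Set (Fin (arity i) → A)) : (relVars arity).Structure A where
  funMap := fun f _ => Empty.elim f
  RelMap := fun R a => (fun j => a (Fin.cast R.2 j)) ∈ X R.1

/-- An ESO-sentence `∃X₁ … ∃Xₖ φ`, where `φ` is a first-order sentence over the vocabulary
extended by the symbols `X₁, …, Xₖ`. -/
structure ESOSentence (L : FirstOrder.Language.{u, v}) where
  k : ℕ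
  arity : Fin k → ℕ
  body : (L.sum (relVars arity)).Sentence

def ESOSentence.Realize {L : FirstOrder.Language.{u, v}} (φ : ESOSentence L) (A : Type w)
    [L.Structure A] : Prop :=
  ∃ X : (i : Fin φ.k) → Set (Fin (φ.arity i) → A),
    letI : (relVars φ.arity).Structure A := relVars.structure X
    FirstOrder.Language.Sentence.Realize A φ.body

/-! ### The logic `L_RE` -/

/-- The relation symbols of the vocabulary `{Y}`, with `Y` unary. -/
inductive YRel : ℕ → Type
  | Y : YRel 1

/-- The vocabulary `{Y}`, with `Y` unary. -/
def YLang : FirstOrder.Language.{0, 0} where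
  Functions := fun _ => Empty
  Relations := YRel

/-- In a bloated domain, `Y` is interpreted by the set of fresh elements. -/
instance Bloat.yStructure (A : Type w) (S : Type) : YLang.Structure (Bloat A S) where
  funMap := fun f _ => Empty.elim f
  RelMap := fun R => match R with
    | YRel.Y => fun a => a 0 ∈ Bloat.fresh A S

/-- A sentence `IY ψ` of `L_RE`, where `ψ` is an ESO-sentence over the vocabulary extended
by `Y`. -/
structure LRESentence (L : FirstOrder.Language.{u, v}) where
  body : ESOSentence (L.sum YLang)

/-- `𝔄 ⊨ IY ψ` iff `(𝔄 + S, Y ↦ S) ⊨ ψ` for some finite nonempty set `S` of fresh elements. -/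
def LRESentence.Realize {L : FirstOrder.Language.{u, v}} [L.IsRelational] (φ : LRESentence L)
    (A : Type w) [L.Structure A] : Prop :=
  ∃ S : Type, Finite S ∧ Nonempty S ∧ φ.body.Realize (Bloat A S)

end TeamLogic

namespace TeamLogic

open FirstOrder

/-! ### Team extensions -/

/-! The sentence IY ∃X₁…∃Xₖ θ becomes Iy ∀(tuples) ∃(constants, table entries, bit) `matrix θ`.
After these quantifiers the team itself stores the second-order data: y takes exactly the values in
S, the tuple variables of Xⱼ take all values, and `negVar j` is forced by a dependence atom to be a
function of the j-th tuple, namely the characteristic function of the complement of Xⱼ. Two distinct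
constants serve as truth values; they exist because the bloated domain has an old and a fresh
element.

θ cannot be translated connective by connective: a team disjunction splits the team, and a part may
no longer contain all of S or all tuples. Instead every subformula receives a variable for its truth
value, and `code` asserts on the undivided team that these values are correct. Only flat formulas
are ever joined by a disjunction. Membership in S is decided with an inclusion and an exclusion atom
against y, membership in Xⱼ with one exclusion atom against the stored complement.

`IsCodeTeam` is the invariant that the team still stores S and the Xⱼ; it survives every extension
by local variables (`IsCodeTeam.extends`). Under it, induction on θ gives `sat_code`: `code φ m`
holds iff `bitVar m` is the truth value of φ at every member. `sat_translate` then converts between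
relations Xⱼ and teams, and the main theorem applies it to each S separately. -/

/-- `V'` arises from `V` by assigning values to the variables in `l`, with at least one extension
for every member of `V`. -/
def Team.Extends {B : Type w} (l : List Var) (V V' : Team B) : Prop :=
  (∀ t ∈ V', ∃ s ∈ V, (∀ v ∉ l, t v = s v) ∧ ∀ v ∈ l, ∃ a, t v = some a) ∧
    ∀ s ∈ V, ∃ t ∈ V', (∀ v ∉ l, t v = s v) ∧ ∀ v ∈ l, ∃ a, t v = some a

theorem Team.extends_image {B : Type w} {l : List Var} {V : Team B}
    {g : Assignment B → Assignment B} (h : ∀ s ∈ V, ∀ v ∉ l, g s v = s v)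
    (h' : ∀ s ∈ V, ∀ v ∈ l, ∃ a, g s v = some a) : Team.Extends l V (g '' V) := by
  refine ⟨?_, fun s hs => ⟨g s, ⟨s, hs, rfl⟩, h s hs, h' s hs⟩⟩
  rintro _ ⟨s, hs, rfl⟩
  exact ⟨s, hs, h s hs, h' s hs⟩

/-- All extensions of members of `V` by values for the variables in `l`. -/
def Team.full {B : Type w} (l : List Var) (V : Team B) : Team B :=
  {t | ∃ s ∈ V, (∀ v ∉ l, t v = s v) ∧ ∀ v ∈ l, ∃ a, t v = some a}

theorem Team.duplicate_univ {B : Type w} (x : Var) (V : Team B) :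
    V.duplicate x Set.univ = V.full [x] := by
  ext t
  constructor
  · rintro ⟨s, hs, a, -, rfl⟩
    refine ⟨s, hs, fun v hv => ?_, fun v hv => ⟨a, ?_⟩⟩
    · simp only [List.mem_singleton] at hv
      simp [Assignment.set, hv]
    · simp only [List.mem_singleton] at hv
      simp [Assignment.set, hv]
  · rintro ⟨s, hs, h, h'⟩
    obtain ⟨a, ha⟩ := h' x (by simp)
    refine ⟨s, hs, a, trivial, ?_⟩
    funext v
    by_cases hv : v = x
    · subst hv; simp [Assignment.set, ha]
    · simp [Assignment.set, hv, h v (by simpa using hv)]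

theorem Team.full_full {B : Type w} (x : Var) (l : List Var) (V : Team B) :
    (V.full [x]).full l = V.full (x :: l) := by
  ext t
  constructor
  · rintro ⟨r, ⟨s, hs, h1, h2⟩, h3, h4⟩
    refine ⟨s, hs, fun v hv => ?_, fun v hv => ?_⟩
    · simp only [List.mem_cons, not_or] at hv
      rw [h3 v hv.2, h1 v (by simpa using hv.1)]
    · by_cases hl : v ∈ l
      · exact h4 v hl
      · rw [h3 v hl]
        exact h2 v (by simpa [hl] using hv)
  · rintro ⟨s, hs, h1, h2⟩
    obtain ⟨a, ha⟩ := h2 x (by simp)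
    refine ⟨s.set x a, ⟨s, hs, fun v hv => ?_, fun v hv => ⟨a, ?_⟩⟩, fun v hv => ?_,
      fun v hv => h2 v (by simp [hv])⟩
    · simp only [List.mem_singleton] at hv
      simp [Assignment.set, hv]
    · simp only [List.mem_singleton] at hv
      simp [Assignment.set, hv]
    · by_cases hx : v = x
      · subst hx; simp [Assignment.set, ha]
      · simp [Assignment.set, hx, h1 v (by simp [hv, hx])]

theorem Team.extends_full {B : Type w} [Nonempty B] (l : List Var) (V : Team B) :
    Team.Extends l V (V.full l) := by
  classical
  obtain ⟨d⟩ := ‹Nonempty B›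
  refine ⟨fun t ht => ht, fun s hs => ?_⟩
  have h1 : ∀ v ∉ l, (fun v => if v ∈ l then some d else s v) v = s v := fun v hv => by simp [hv]
  have h2 : ∀ v ∈ l, ∃ a, (fun v => if v ∈ l then some d else s v) v = some a :=
    fun v hv => ⟨d, by simp [hv]⟩
  exact ⟨_, ⟨s, hs, h1, h2⟩, h1, h2⟩

theorem Team.supplement_extends {B : Type w} {x : Var} {V : Team B} {f : Assignment B → Set B}
    (hf : ∀ s ∈ V, (f s).Nonempty) : Team.Extends [x] V (V.supplement x f) := by
  have key : ∀ (s : Assignment B) a, (∀ v ∉ [x], s.set x a v = s v) ∧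
      ∀ v ∈ [x], ∃ c, s.set x a v = some c := by
    intro s a
    refine ⟨fun v hv => ?_, fun v hv => ⟨a, ?_⟩⟩ <;> simp only [List.mem_singleton] at hv <;>
      simp [Assignment.set, hv]
  constructor
  · rintro _ ⟨s, hs, a, -, rfl⟩
    exact ⟨s, hs, key s a⟩
  · intro s hs
    obtain ⟨a, ha⟩ := hf s hs
    exact ⟨_, ⟨s, hs, a, ha, rfl⟩, key s a⟩

/-- The choice function is read back from `V'`. Lax semantics matters here: since it is set-valued,
every extension team arises from some choice. -/
theorem Team.Extends.eq_supplement {B : Type w} {x : Var} {V V' : Team B}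
    (h : Team.Extends [x] V V') :
    (∀ s ∈ V, {a | s.set x a ∈ V'}.Nonempty) ∧
      V' = V.supplement x fun s => {a | s.set x a ∈ V'} := by
  have key : ∀ s t : Assignment B, (∀ v ∉ [x], t v = s v) → (∀ v ∈ [x], ∃ a, t v = some a) →
      ∃ a, t = s.set x a := by
    intro s t h1 h2
    obtain ⟨a, ha⟩ := h2 x (by simp)
    refine ⟨a, funext fun v => ?_⟩
    by_cases hv : v = x
    · subst hv; simp [Assignment.set, ha]
    · simp [Assignment.set, hv, h1 v (by simpa using hv)]
  constructor
  · intro s hs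
    obtain ⟨t, ht, h1, h2⟩ := h.2 s hs
    obtain ⟨a, rfl⟩ := key s t h1 h2
    exact ⟨a, ht⟩
  · ext t
    constructor
    · intro ht
      obtain ⟨s, hs, h1, h2⟩ := h.1 t ht
      obtain ⟨a, rfl⟩ := key s t h1 h2
      exact ⟨s, hs, a, ht, rfl⟩
    · rintro ⟨s, -, a, ha, rfl⟩
      exact ha

theorem Team.Extends.trans {B : Type w} {x : Var} {l : List Var} {V V₁ V' : Team B}
    (h : Team.Extends [x] V V₁) (h' : Team.Extends l V₁ V') : Team.Extends (x :: l) V V' := by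
  have key : ∀ s r t : Assignment B, ((∀ v ∉ [x], r v = s v) ∧ ∀ v ∈ [x], ∃ a, r v = some a) →
      ((∀ v ∉ l, t v = r v) ∧ ∀ v ∈ l, ∃ a, t v = some a) →
      (∀ v ∉ x :: l, t v = s v) ∧ ∀ v ∈ x :: l, ∃ a, t v = some a := by
    rintro s r t ⟨h1, h2⟩ ⟨h3, h4⟩
    refine ⟨fun v hv => ?_, fun v hv => ?_⟩
    · simp only [List.mem_cons, not_or] at hv
      rw [h3 v hv.2, h1 v (by simpa using hv.1)]
    · by_cases hl : v ∈ l
      · exact h4 v hl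
      · rw [h3 v hl]
        exact h2 v (by simpa [hl] using hv)
  constructor
  · intro t ht
    obtain ⟨r, hr, h1⟩ := h'.1 t ht
    obtain ⟨s, hs, h2⟩ := h.1 r hr
    exact ⟨s, hs, key s r t h2 h1⟩
  · intro s hs
    obtain ⟨r, hr, h1⟩ := h.2 s hs
    obtain ⟨t, ht, h2⟩ := h'.2 r hr
    exact ⟨t, ht, key s r t h1 h2⟩

/-- The intermediate team consists of all `s[t(x)/x]` for `s ∈ V` and `t ∈ V'` extending `s`. -/
theorem Team.Extends.exists_between {B : Type w} {x : Var} {l : List Var} {V V' : Team B}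
    (h : Team.Extends (x :: l) V V') :
    ∃ V₁, Team.Extends [x] V V₁ ∧ Team.Extends l V₁ V' := by
  classical
  have key : ∀ s t : Assignment B, (∀ v ∉ x :: l, t v = s v) →
      (∀ v ∈ x :: l, ∃ a, t v = some a) →
      ((∀ v ∉ [x], Function.update s x (t x) v = s v) ∧
        ∀ v ∈ [x], ∃ a, Function.update s x (t x) v = some a) ∧
      ((∀ v ∉ l, t v = Function.update s x (t x) v) ∧ ∀ v ∈ l, ∃ a, t v = some a) := by
    intro s t h1 h2
    refine ⟨⟨fun v hv => ?_, fun v hv => ?_⟩, fun v hv => ?_, fun v hv => h2 v (by simp [hv])⟩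
    · simp only [List.mem_singleton] at hv
      simp [hv]
    · simp only [List.mem_singleton] at hv
      subst hv
      simpa using h2 v (by simp)
    · by_cases hx : v = x
      · subst hx; simp
      · simp [hx, h1 v (by simp [hv, hx])]
  refine ⟨{r | ∃ t ∈ V', ∃ s ∈ V, (∀ v ∉ x :: l, t v = s v) ∧
    (∀ v ∈ x :: l, ∃ a, t v = some a) ∧ r = Function.update s x (t x)}, ⟨?_, ?_⟩, ?_, ?_⟩
  · rintro _ ⟨t, ht, s, hs, h1, h2, rfl⟩
    exact ⟨s, hs, (key s t h1 h2).1⟩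
  · intro s hs
    obtain ⟨t, ht, h1, h2⟩ := h.2 s hs
    exact ⟨_, ⟨t, ht, s, hs, h1, h2, rfl⟩, (key s t h1 h2).1⟩
  · intro t ht
    obtain ⟨s, hs, h1, h2⟩ := h.1 t ht
    exact ⟨_, ⟨t, ht, s, hs, h1, h2, rfl⟩, (key s t h1 h2).2⟩
  · rintro _ ⟨t, ht, s, hs, h1, h2, rfl⟩
    exact ⟨t, ht, (key s t h1 h2).2⟩

/-! ### Blocks of quantifiers -/

namespace DStarFormula

variable {L : FirstOrder.Language.{u, v}}

/-- `∀x₁ … ∀xₙ φ`. -/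
def allMany (l : List Var) (φ : DStarFormula L) : DStarFormula L := l.foldr all φ

/-- `∃x₁ … ∃xₙ φ`. -/
def exMany (l : List Var) (φ : DStarFormula L) : DStarFormula L := l.foldr ex φ

theorem freeVars_allMany (l : List Var) (φ : DStarFormula L) :
    (allMany l φ).freeVars = φ.freeVars \ {v | v ∈ l} := by
  induction l with
  | nil => simp [allMany]
  | cons x l ih =>
    change (allMany l φ).freeVars \ {x} = _
    rw [ih]
    ext v
    simp only [Set.mem_sdiff, Set.mem_ofPred_eq, Set.mem_singleton_iff, List.mem_cons]
    tauto

theorem freeVars_exMany (l : List Var) (φ : DStarFormula L) :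
    (exMany l φ).freeVars = φ.freeVars \ {v | v ∈ l} := by
  induction l with
  | nil => simp [exMany]
  | cons x l ih =>
    change (exMany l φ).freeVars \ {x} = _
    rw [ih]
    ext v
    simp only [Set.mem_sdiff, Set.mem_ofPred_eq, Set.mem_singleton_iff, List.mem_cons]
    tauto

variable [L.IsRelational] {B : Type w} [L.Structure B]

theorem sat_allMany (l : List Var) (φ : DStarFormula L) (V : Team B) :
    (allMany l φ).Sat B V ↔ φ.Sat B (V.full l) := by
  induction l generalizing V with
  | nil =>
    have : V.full [] = V := by
      ext t
      constructor
      · rintro ⟨s, hs, h, -⟩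
        rwa [show t = s from funext fun v => h v (by simp)]
      · exact fun ht => ⟨t, ht, fun _ _ => rfl, by simp⟩
    rw [this]
    rfl
  | cons x l ih =>
    change (allMany l φ).Sat B (V.duplicate x Set.univ) ↔ _
    rw [ih, Team.duplicate_univ, Team.full_full]

/-- Replaces iterated choice functions by a single extension team, so that later witnesses can be
given as an image `g '' V`. -/
theorem sat_exMany (l : List Var) (φ : DStarFormula L) (V : Team B) :
    (exMany l φ).Sat B V ↔ ∃ V', Team.Extends l V V' ∧ φ.Sat B V' := by
  induction l generalizing V with
  | nil =>
    constructor
    · intro h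
      exact ⟨V, ⟨fun t ht => ⟨t, ht, fun _ _ => rfl, by simp⟩,
        fun t ht => ⟨t, ht, fun _ _ => rfl, by simp⟩⟩, h⟩
    · rintro ⟨V', h, hφ⟩
      have : V' = V := by
        ext t
        constructor
        · intro ht
          obtain ⟨s, hs, h1, -⟩ := h.1 t ht
          rwa [show t = s from funext fun v => h1 v (by simp)]
        · intro ht
          obtain ⟨s, hs, h1, -⟩ := h.2 t ht
          rwa [show t = s from funext fun v => (h1 v (by simp)).symm]
      exact this ▸ hφ
  | cons x l ih =>
    constructor
    · rintro ⟨f, hf, h⟩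
      obtain ⟨V', h1, h2⟩ := (ih _).1 h
      exact ⟨V', (Team.supplement_extends hf).trans h1, h2⟩
    · rintro ⟨V', h1, h2⟩
      obtain ⟨V₁, h3, h4⟩ := h1.exists_between
      obtain ⟨h5, h6⟩ := h3.eq_supplement
      exact ⟨_, h5, (ih _).2 ⟨V', h6 ▸ h4, h2⟩⟩

/-- A formula that is flat: a team satisfies it iff all of its members satisfy `P`. -/
def IsFlat (φ : DStarFormula L) (B : Type w) [L.Structure B] (P : Assignment B → Prop) : Prop :=
  ∀ V : Team B, φ.Sat B V ↔ ∀ s ∈ V, P s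

theorem isFlat_eq (x y : Var) : (eq x y : DStarFormula L).IsFlat B fun s => s x = s y :=
  fun _ => Iff.rfl

theorem isFlat_neq (x y : Var) : (neq x y : DStarFormula L).IsFlat B fun s => s x ≠ s y :=
  fun _ => Iff.rfl

theorem isFlat_rel {k : ℕ} (R : L.Relations k) (x : Fin k → Var) :
    (rel R x).IsFlat B fun s => ∃ a : Fin k → B, (∀ i, s (x i) = some (a i)) ∧
      FirstOrder.Language.Structure.RelMap R a :=
  fun _ => Iff.rfl

theorem isFlat_nrel {k : ℕ} (R : L.Relations k) (x : Fin k → Var) :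
    (nrel R x).IsFlat B fun s => ∃ a : Fin k → B, (∀ i, s (x i) = some (a i)) ∧
      ¬ FirstOrder.Language.Structure.RelMap R a :=
  fun _ => Iff.rfl

theorem IsFlat.and {φ ψ : DStarFormula L} {P Q : Assignment B → Prop} (hφ : φ.IsFlat B P)
    (hψ : ψ.IsFlat B Q) : (φ.and ψ).IsFlat B fun s => P s ∧ Q s := by
  intro V
  change φ.Sat B V ∧ ψ.Sat B V ↔ _
  rw [hφ V, hψ V]
  exact ⟨fun h s hs => ⟨h.1 s hs, h.2 s hs⟩, fun h => ⟨fun s hs => (h s hs).1, fun s hs => (h s hs).2⟩⟩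

/-- The team is split by the pointwise properties; the two parts may overlap. Every disjunction in
the translation is of this kind. -/
theorem IsFlat.or {φ ψ : DStarFormula L} {P Q : Assignment B → Prop} (hφ : φ.IsFlat B P)
    (hψ : ψ.IsFlat B Q) : (φ.or ψ).IsFlat B fun s => P s ∨ Q s := by
  intro V
  constructor
  · rintro ⟨V₀, V₁, rfl, h0, h1⟩ s (hs | hs)
    · exact .inl ((hφ V₀).1 h0 s hs)
    · exact .inr ((hψ V₁).1 h1 s hs)
  · intro h
    refine ⟨{s ∈ V | P s}, {s ∈ V | Q s}, ?_, (hφ _).2 fun s hs => hs.2, (hψ _).2 fun s hs => hs.2⟩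
    ext s
    constructor
    · rintro (hs | hs) <;> exact hs.1
    · exact fun hs => (h s hs).imp (⟨hs, ·⟩) (⟨hs, ·⟩)

end DStarFormula

/-! ### The variables of the translation -/

/-- The variable ranging over the fresh elements. -/
def freshVar : ℕ := 0

/-- The constant for the truth value `false`. -/
def zeroVar : ℕ := 1

/-- The constant for the truth value `true`. -/
def oneVar : ℕ := 2

/-- An auxiliary variable ranging over fresh elements. -/
def inVar : ℕ := 3

/-- An auxiliary variable ranging over old elements. -/
def outVar : ℕ := 4

/-- The first-order variables of the translated formula. -/
def argVar (i : ℕ) : ℕ := 5 + 4 * i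

/-- The variables for the truth values of subformulas. -/
def bitVar (m : ℕ) : ℕ := 6 + 4 * m

/-- The variables of the tuple of arguments of the `j`-th relation variable. -/
def tupVar (j i : ℕ) : ℕ := 7 + 4 * Nat.pair j i

/-- The negated truth value of the `j`-th relation variable at its tuple of arguments. -/
def negVar (j : ℕ) : ℕ := 8 + 4 * j

/-- The variables that may be quantified inside the translation of a formula. -/
def IsLocal (v : ℕ) : Prop :=
  v = inVar ∨ v = outVar ∨ (∃ i, v = argVar i) ∨ ∃ m, v = bitVar m

theorem isLocal_argVar (i : ℕ) : IsLocal (argVar i) := .inr (.inr (.inl ⟨i, rfl⟩))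

theorem isLocal_bitVar (m : ℕ) : IsLocal (bitVar m) := .inr (.inr (.inr ⟨m, rfl⟩))

/-- The variables that store S, the constants and the tables must never be requantified inside
`code`. The indexed families are told apart by their residues modulo 4, and all lie above the five
single variables. -/
theorem not_isLocal_freshVar : ¬ IsLocal freshVar := by
  simp only [IsLocal, freshVar, inVar, outVar, argVar, bitVar]
  rintro (h | h | ⟨i, h⟩ | ⟨i, h⟩) <;> omega

theorem not_isLocal_zeroVar : ¬ IsLocal zeroVar := by
  simp only [IsLocal, zeroVar, inVar, outVar, argVar, bitVar]
  rintro (h | h | ⟨i, h⟩ | ⟨i, h⟩) <;> omega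

theorem not_isLocal_oneVar : ¬ IsLocal oneVar := by
  simp only [IsLocal, oneVar, inVar, outVar, argVar, bitVar]
  rintro (h | h | ⟨i, h⟩ | ⟨i, h⟩) <;> omega

theorem not_isLocal_tupVar (j i : ℕ) : ¬ IsLocal (tupVar j i) := by
  simp only [IsLocal, tupVar, inVar, outVar, argVar, bitVar]
  rintro (h | h | ⟨i, h⟩ | ⟨i, h⟩) <;> omega

theorem not_isLocal_negVar (j : ℕ) : ¬ IsLocal (negVar j) := by
  simp only [IsLocal, negVar, inVar, outVar, argVar, bitVar]
  rintro (h | h | ⟨i, h⟩ | ⟨i, h⟩) <;> omega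

theorem argVar_injective : Function.Injective argVar := fun i j h => by
  simp only [argVar] at h; omega

theorem bitVar_injective : Function.Injective bitVar := fun i j h => by
  simp only [bitVar] at h; omega

theorem argVar_ne_bitVar (i m : ℕ) : argVar i ≠ bitVar m := by
  simp only [argVar, bitVar]; omega

theorem tupVar_inj {j i j' i' : ℕ} : tupVar j i = tupVar j' i' ↔ j = j' ∧ i = i' := by
  rw [← Nat.pair_eq_pair]
  simp only [tupVar]; omega

/-! ### Relational vocabularies -/

instance : YLang.IsRelational := fun _ => inferInstanceAs (IsEmpty Empty)

instance {k : ℕ} (arity : Fin k → ℕ) : (relVars arity).IsRelational :=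
  fun _ => inferInstanceAs (IsEmpty Empty)

/-- In a relational vocabulary, every term is a variable. -/
def termIndex {L : FirstOrder.Language.{u, v}} [L.IsRelational] {n : ℕ} : L.Term (Empty ⊕ Fin n) → Fin n
  | .var (.inl e) => e.elim
  | .var (.inr i) => i
  | .func f _ => isEmptyElim f

theorem realize_eq_termIndex {L : FirstOrder.Language.{u, v}} [L.IsRelational] {B : Type w} [L.Structure B]
    {n : ℕ} (t : L.Term (Empty ⊕ Fin n)) (e : Empty → B) (xs : Fin n → B) :
    t.realize (Sum.elim e xs) = xs (termIndex t) := by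
  match t with
  | .var (.inl e) => exact e.elim
  | .var (.inr i) => rfl
  | .func f _ => exact isEmptyElim f

/-! ### The translation of first-order formulas -/

section Code

variable {L : FirstOrder.Language.{u, v}} [L.IsRelational] {k : ℕ} {arity : Fin k → ℕ}

namespace DStarFormula

/-- The truth value `b` equals `1` and `φ` holds, or it equals `0` and `ψ` holds. -/
def decides (b : Var) (φ ψ : DStarFormula L) : DStarFormula L :=
  ((eq b oneVar).and φ).or ((eq b zeroVar).and ψ)

/-- The formula stating that `bitVar m` is the truth value of the given first-order formula. -/
def code : {n : ℕ} → ((L.sum YLang).sum (relVars arity)).BoundedFormula Empty n → ℕ →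
    DStarFormula L
  | _, .falsum, m => eq (bitVar m) zeroVar
  | _, .equal t₁ t₂, m =>
    decides (bitVar m) (eq (argVar (termIndex t₁)) (argVar (termIndex t₂)))
      (neq (argVar (termIndex t₁)) (argVar (termIndex t₂)))
  | _, .rel (.inl (.inl R)) ts, m =>
    decides (bitVar m) (rel R fun i => argVar (termIndex (ts i)))
      (nrel R fun i => argVar (termIndex (ts i)))
  -- `inVar` takes values in S and `outVar` values outside S, so equality with one of them decides
  -- membership.
  | _, .rel (.inl (.inr YRel.Y)) ts, m =>
    exMany [inVar, outVar]
      (((incl (k := 0) (fun _ => inVar) fun _ => freshVar).and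
        (excl (k := 0) (fun _ => outVar) fun _ => freshVar)).and
        (decides (bitVar m) (eq (argVar (termIndex (ts 0))) inVar)
          (eq (argVar (termIndex (ts 0))) outVar)))
  -- The tuple variables take every value, so the exclusion atom compares the bit with the stored
  -- negated value at the same arguments and forces them to differ.
  | _, .rel (.inr R) ts, m =>
    ((eq (bitVar m) oneVar).or (eq (bitVar m) zeroVar)).and
      (excl (Fin.cons (bitVar m) fun i => argVar (termIndex (ts i)))
        (Fin.cons (negVar R.1) fun i => tupVar R.1 i))
  -- `code φ (m + 1)` may rebind `bitVar (m + 2)` internally. This is harmless: the only bit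
  -- variable it reads from outside is `bitVar (m + 1)`.
  | _, .imp φ ψ, m =>
    exMany [bitVar (m + 1), bitVar (m + 2)]
      ((code φ (m + 1)).and ((code ψ (m + 2)).and
        (decides (bitVar m) ((eq (bitVar (m + 1)) zeroVar).or (eq (bitVar (m + 2)) oneVar))
          ((eq (bitVar (m + 1)) oneVar).and (eq (bitVar (m + 2)) zeroVar)))))
  -- The first conjunct says that bit 1 requires φ for all values; the second that bit 0 requires a
  -- counterexample.
  | n, .all φ, m =>
    (allMany [argVar n] (exMany [bitVar (m + 1)] ((code φ (m + 1)).and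
      ((eq (bitVar m) zeroVar).or ((eq (bitVar m) oneVar).and
        (eq (bitVar (m + 1)) oneVar)))))).and
    (exMany [argVar n, bitVar (m + 1)] ((code φ (m + 1)).and
      ((eq (bitVar m) oneVar).or ((eq (bitVar m) zeroVar).and
        (eq (bitVar (m + 1)) zeroVar)))))

/-- The variables that may be free in `code φ m`. -/
def codeVars (arity : Fin k → ℕ) (n m : ℕ) : Set Var :=
  {v | v = freshVar ∨ v = zeroVar ∨ v = oneVar ∨ v = bitVar m ∨
    (∃ (j : Fin k) (i : Fin (arity j)), v = tupVar j i) ∨ (∃ j : Fin k, v = negVar j) ∨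
    ∃ i < n, v = argVar i}

/-- Needed to see that the final translation is a sentence. At a universal quantifier the extra
variable `argVar n` is bound, which brings the bound n + 1 back to n. -/
theorem freeVars_code {n : ℕ} (φ : ((L.sum YLang).sum (relVars arity)).BoundedFormula Empty n)
    (m : ℕ) : (code φ m).freeVars ⊆ codeVars arity n m := by
  induction φ generalizing m with
  | falsum =>
    intro v hv
    simp only [code, freeVars, Set.mem_insert_iff, Set.mem_singleton_iff] at hv
    simp only [codeVars, Set.mem_ofPred_eq]
    tauto
  | @equal n t₁ t₂ =>
    have h1 : ∃ i < n, argVar (termIndex t₁) = argVar i := ⟨_, (termIndex t₁).2, rfl⟩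
    have h2 : ∃ i < n, argVar (termIndex t₂) = argVar i := ⟨_, (termIndex t₂).2, rfl⟩
    intro v hv
    simp only [code, decides, freeVars, Set.mem_insert_iff, Set.mem_singleton_iff,
      Set.mem_union] at hv
    simp only [codeVars, Set.mem_ofPred_eq]
    rcases hv with ((rfl | rfl) | (rfl | rfl)) | ((rfl | rfl) | (rfl | rfl)) <;> tauto
  | @rel n l R ts =>
    have hts : ∀ i, ∃ i' < n, argVar (termIndex (ts i)) = argVar i' :=
      fun i => ⟨_, (termIndex (ts i)).2, rfl⟩
    intro v hv
    simp only [codeVars, Set.mem_ofPred_eq]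
    match R with
    | .inl (.inl R) =>
      simp only [code, decides, freeVars, Set.mem_insert_iff, Set.mem_singleton_iff,
        Set.mem_union, Set.mem_range] at hv
      rcases hv with ((rfl | rfl) | ⟨i, rfl⟩) | ((rfl | rfl) | ⟨i, rfl⟩) <;>
        tauto
    | .inl (.inr YRel.Y) =>
      have := hts 0
      simp only [code, freeVars_exMany, decides, freeVars, Set.mem_insert_iff,
        Set.mem_singleton_iff, Set.mem_union, Set.mem_range, Set.mem_sdiff, exists_const,
        Set.mem_ofPred_eq, List.mem_cons, List.not_mem_nil, or_false] at hv
      rcases hv with ⟨hv, hv'⟩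
      rcases hv with ((hv | hv) | (hv | hv)) | (((hv | hv) | (hv | hv)) | ((hv | hv) | (hv | hv)))
        <;> subst hv <;> tauto
    | .inr R =>
      obtain ⟨j, rfl⟩ := R
      simp only [code, freeVars, Set.mem_insert_iff, Set.mem_singleton_iff,
        Set.mem_union, Set.mem_range] at hv
      rcases hv with ((rfl | rfl) | (rfl | rfl)) | (⟨i, rfl⟩ | ⟨i, rfl⟩)
      · tauto
      · tauto
      · tauto
      · tauto
      · refine Fin.cases ?_ (fun i => ?_) i
        · simp
        · have := hts i
          simp only [Fin.cons_succ]
          tauto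
      · refine Fin.cases ?_ (fun i => ?_) i
        · have : ∃ j' : Fin k, negVar j = negVar j' := ⟨j, rfl⟩
          simp only [Fin.cons_zero]
          tauto
        · have : ∃ (j' : Fin k) (i' : Fin (arity j')), tupVar j i = tupVar j' i' := ⟨j, i, rfl⟩
          simp only [Fin.cons_succ]
          exact .inr (.inr (.inr (.inr (.inl this))))
  | @imp n φ ψ ih1 ih2 =>
    intro v hv
    simp only [code, freeVars_exMany, decides, freeVars, Set.mem_insert_iff,
        Set.mem_singleton_iff, Set.mem_union, Set.mem_sdiff,
        Set.mem_ofPred_eq, List.mem_cons, List.not_mem_nil, or_false] at hv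
    have h1 := @ih1 (m + 1) v
    have h2 := @ih2 (m + 2) v
    simp only [codeVars, Set.mem_ofPred_eq] at h1 h2 ⊢
    grind
  | @all n φ ih =>
    intro v hv
    simp only [code, freeVars_exMany, freeVars_allMany, freeVars, Set.mem_insert_iff,
        Set.mem_singleton_iff, Set.mem_union, Set.mem_sdiff,
        Set.mem_ofPred_eq, List.mem_cons, List.not_mem_nil, or_false] at hv
    have h1 := @ih (m + 1) v
    have h2 : (∃ i < n + 1, v = argVar i) → (∃ i < n, v = argVar i) ∨ v = argVar n := by
      rintro ⟨i, hi, rfl⟩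
      rcases Nat.lt_succ_iff_lt_or_eq.1 hi with h | rfl
      · exact .inl ⟨i, h, rfl⟩
      · exact .inr rfl
    simp only [codeVars, Set.mem_ofPred_eq] at h1 ⊢
    grind

end DStarFormula

end Code

/-! ### Correctness of the translation -/

open Classical in
/-- The truth value of `P`, as one of two elements. -/
noncomputable def bit {B : Type w} (e₀ e₁ : B) (P : Prop) : B := if P then e₁ else e₀

theorem bit_of_true {B : Type w} {e₀ e₁ : B} {P : Prop} (h : P) : bit e₀ e₁ P = e₁ := if_pos h

theorem bit_of_false {B : Type w} {e₀ e₁ : B} {P : Prop} (h : ¬ P) : bit e₀ e₁ P = e₀ := if_neg h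

/-- Brings correctness of a truth value into the disjunctive shape of `decides`. -/
theorem some_eq_bit_iff {B : Type w} {e₀ e₁ : B} {P : Prop} {o : Option B} :
    o = some (bit e₀ e₁ P) ↔ (o = some e₁ ∧ P) ∨ (o = some e₀ ∧ ¬ P) := by
  by_cases h : P
  · rw [bit_of_true h]; simp [h]
  · rw [bit_of_false h]; simp [h]

/-- The values of the first-order variables. -/
noncomputable def args {B : Type w} [Nonempty B] (n : ℕ) (s : Assignment B) : Fin n → B :=
  -- The default is immaterial on members of a code team, where these variables have values
  -- (`IsCodeTeam.apply_argVar`).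
  fun i => (s (argVar i)).getD (Classical.arbitrary B)

theorem args_congr {B : Type w} [Nonempty B] {n : ℕ} {s t : Assignment B}
    (h : ∀ i < n, t (argVar i) = s (argVar i)) : args n t = args n s := by
  funext i
  simp [args, h i i.2]

theorem args_succ {B : Type w} [Nonempty B] {n : ℕ} {s t : Assignment B} {a : B}
    (h : ∀ i < n, t (argVar i) = s (argVar i)) (ha : t (argVar n) = some a) :
    args (n + 1) t = (Fin.snoc (args n s) a : Fin (n + 1) → B) := by
  funext i
  refine Fin.lastCases ?_ (fun i => ?_) i
  · simp [args, ha]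
  · simp [args, h i i.2]

/-- The `j`-th relation variable. -/
def relVars.symbol {k : ℕ} (arity : Fin k → ℕ) (j : Fin k) :
    (relVars arity).Relations (arity j) := ⟨j, rfl⟩

section Correctness

variable {L : FirstOrder.Language.{u, v}} [L.IsRelational] {k : ℕ} {arity : Fin k → ℕ}
variable {B : Type w} [L.Structure B] [(relVars arity).Structure B]

/-- The teams in which the translations of first-order formulas are evaluated. -/
structure IsCodeTeam (arity : Fin k → ℕ) [(relVars arity).Structure B] (S : Set B) (e₀ e₁ : B)
    (n : ℕ) (V : Team B) : Prop where
  fresh_mem : ∀ s ∈ V, ∃ a ∈ S, s freshVar = some a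
  fresh_surj : ∀ a ∈ S, ∃ s ∈ V, s freshVar = some a
  zero : ∀ s ∈ V, s zeroVar = some e₀
  one : ∀ s ∈ V, s oneVar = some e₁
  tup : ∀ s ∈ V, ∀ j, ∃ a : Fin (arity j) → B, (∀ i : Fin (arity j), s (tupVar j i) = some (a i)) ∧
    s (negVar j) = some (bit e₀ e₁
      (¬ FirstOrder.Language.Structure.RelMap (relVars.symbol arity j) a))
  tup_surj : ∀ j, ∀ a : Fin (arity j) → B,
    ∃ s ∈ V, ∀ i : Fin (arity j), s (tupVar j i) = some (a i)
  arg : ∀ s ∈ V, ∀ i < n, ∃ a, s (argVar i) = some a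

/-- The conditions on stored data concern non-local variables and speak either of all members or of
the existence of one. The former pass to `V'` because its members extend members of `V`, the latter
because every member of `V` is extended. A subteam could lose the existence conditions. -/
theorem IsCodeTeam.extends {S : Set B} {e₀ e₁ : B} {n n' : ℕ} {V V' : Team B} {l : List Var}
    (h : IsCodeTeam arity S e₀ e₁ n V) (hV : Team.Extends l V V') (hl : ∀ v ∈ l, IsLocal v)
    (hn : ∀ i < n', argVar i ∈ l ∨ i < n) : IsCodeTeam arity S e₀ e₁ n' V' := by
  have hf : freshVar ∉ l := fun h => not_isLocal_freshVar (hl _ h)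
  have h0 : zeroVar ∉ l := fun h => not_isLocal_zeroVar (hl _ h)
  have h1 : oneVar ∉ l := fun h => not_isLocal_oneVar (hl _ h)
  have ht : ∀ j i, tupVar j i ∉ l := fun j i h => not_isLocal_tupVar j i (hl _ h)
  have hn' : ∀ j, negVar j ∉ l := fun j h => not_isLocal_negVar j (hl _ h)
  constructor
  · intro t hs
    obtain ⟨s, hs, e, -⟩ := hV.1 t hs
    rw [e _ hf]
    exact h.fresh_mem s hs
  · intro a ha
    obtain ⟨s, hs, hsa⟩ := h.fresh_surj a ha
    obtain ⟨t, ht, e, -⟩ := hV.2 s hs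
    exact ⟨t, ht, by rw [e _ hf, hsa]⟩
  · intro t hs
    obtain ⟨s, hs, e, -⟩ := hV.1 t hs
    rw [e _ h0]
    exact h.zero s hs
  · intro t hs
    obtain ⟨s, hs, e, -⟩ := hV.1 t hs
    rw [e _ h1]
    exact h.one s hs
  · intro t hs j
    obtain ⟨s, hs, e, -⟩ := hV.1 t hs
    obtain ⟨a, ha, ha'⟩ := h.tup s hs j
    exact ⟨a, fun i => by rw [e _ (ht _ _), ha], by rw [e _ (hn' _), ha']⟩
  · intro j a
    obtain ⟨s, hs, hsa⟩ := h.tup_surj j a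
    obtain ⟨t, ht', e, -⟩ := hV.2 s hs
    exact ⟨t, ht', fun i => by rw [e _ (ht _ _), hsa]⟩
  · intro t ht i hi
    obtain ⟨s, hs, e, e'⟩ := hV.1 t ht
    by_cases hil : argVar i ∈ l
    · exact e' _ hil
    · rw [e _ hil]
      exact h.arg s hs i ((hn i hi).resolve_left hil)

theorem DStarFormula.isFlat_decides {b : Var} {φ ψ : DStarFormula L} {P Q : Assignment B → Prop}
    (hφ : φ.IsFlat B P) (hψ : ψ.IsFlat B Q) : (DStarFormula.decides b φ ψ).IsFlat B fun s =>
      (s b = s oneVar ∧ P s) ∨ (s b = s zeroVar ∧ Q s) :=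
  ((DStarFormula.isFlat_eq _ _).and hφ).or ((DStarFormula.isFlat_eq _ _).and hψ)

/-- Correctness of `code` for a literal. -/
theorem DStarFormula.sat_decides {S : Set B} {e₀ e₁ : B} {n : ℕ} {V : Team B}
    (hV : IsCodeTeam arity S e₀ e₁ n V) {b : Var} {φ ψ : DStarFormula L}
    {P Q R : Assignment B → Prop} (hφ : φ.IsFlat B P) (hψ : ψ.IsFlat B Q)
    (hP : ∀ s ∈ V, (P s ↔ R s)) (hQ : ∀ s ∈ V, (Q s ↔ ¬ R s)) :
    (DStarFormula.decides b φ ψ).Sat B V ↔ ∀ s ∈ V, s b = some (bit e₀ e₁ (R s)) := by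
  rw [DStarFormula.isFlat_decides hφ hψ V]
  refine forall₂_congr fun s hs => ?_
  beta_reduce
  rw [hV.one s hs, hV.zero s hs, hP s hs, hQ s hs, some_eq_bit_iff]

variable [Nonempty B]

theorem IsCodeTeam.apply_argVar {S : Set B} {e₀ e₁ : B} {n : ℕ} {V : Team B}
    (h : IsCodeTeam arity S e₀ e₁ n V) {s : Assignment B} (hs : s ∈ V) (i : Fin n) :
    s (argVar i) = some (args n s i) := by
  obtain ⟨a, ha⟩ := h.arg s hs i i.2
  simp [args, ha]

namespace DStarFormula

/-- Correctness of the translation of the symbol `Y`. -/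
theorem sat_fresh {S : Set B} (hS : S.Nonempty) (hS' : Sᶜ.Nonempty) {e₀ e₁ : B}
    {n : ℕ} {V : Team B} (hV : IsCodeTeam arity S e₀ e₁ n V) (m : ℕ) (i : Fin n) :
    (exMany [inVar, outVar]
      (((incl (k := 0) (fun _ => inVar) fun _ => freshVar).and
        (excl (k := 0) (fun _ => outVar) fun _ => freshVar)).and
        (decides (bitVar m) (eq (argVar i) inVar) (eq (argVar i) outVar))) :
          DStarFormula L).Sat B V ↔
      ∀ s ∈ V, s (bitVar m) = some (bit e₀ e₁ (args n s i ∈ S)) := by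
  have hl : ∀ v ∈ [inVar, outVar], IsLocal v := by simp [IsLocal]
  have hb : bitVar m ∉ [inVar, outVar] := by simp [inVar, outVar, bitVar]; omega
  have ha : ∀ i, argVar i ∉ [inVar, outVar] := by
    intro i; simp [inVar, outVar, argVar]; omega
  have hio : inVar ≠ outVar := by simp [inVar, outVar]
  rw [sat_exMany]
  constructor
  · rintro ⟨V', hE, ⟨h1, h2⟩, h3⟩ s hs
    have hV' := hV.extends hE hl (n' := n) fun i hi => .inr hi
    obtain ⟨t, ht, e, e'⟩ := hE.2 s hs
    have h3 := (isFlat_decides (isFlat_eq _ _) (isFlat_eq _ _) V').1 h3 t ht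
    beta_reduce at h3
    rw [hV'.one t ht, hV'.zero t ht, e _ hb, e _ (ha _), hV.apply_argVar hs] at h3
    rw [some_eq_bit_iff]
    refine h3.imp (And.imp_right fun h => ?_) (And.imp_right fun h h' => ?_)
    · obtain ⟨r, hr, hr'⟩ := @h1 (fun _ => args n s i) ⟨t, ht, fun _ => h.symm⟩
      obtain ⟨a, haS, har⟩ := hV'.fresh_mem r hr
      have := (hr' 0).symm.trans har
      simp only [Option.some.injEq] at this
      rwa [this]
    · obtain ⟨r, hr, hr'⟩ := hV'.fresh_surj _ h'
      have : (fun _ => args n s i : Fin 1 → B) ∈ (∅ : Set (Fin 1 → B)) := by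
        rw [← h2]
        exact ⟨⟨t, ht, fun _ => h.symm⟩, ⟨r, hr, fun _ => hr'⟩⟩
      exact this
  · intro h
    classical
    obtain ⟨p, hp⟩ := hS
    obtain ⟨q, hq⟩ := hS'
    -- One of the two variables copies the argument; the other is parked at `p ∈ S` or `q ∉ S`.
    -- Hence both S and its complement must be nonempty.
    let g : Assignment B → Assignment B := fun s =>
      (s.set inVar (if args n s i ∈ S then args n s i else p)).set outVar
        (if args n s i ∈ S then q else args n s i)
    have g1 : ∀ s, ∀ v ∉ [inVar, outVar], g s v = s v := by
      intro s v hv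
      simp only [List.mem_cons, List.not_mem_nil, or_false, not_or] at hv
      simp [g, Assignment.set, hv.1, hv.2]
    have g2 : ∀ s, g s inVar = some (if args n s i ∈ S then args n s i else p) := by
      intro s; simp [g, Assignment.set, hio]
    have g3 : ∀ s, g s outVar = some (if args n s i ∈ S then q else args n s i) := by
      intro s; simp [g, Assignment.set]
    have hE : Team.Extends [inVar, outVar] V (g '' V) := by
      refine Team.extends_image (fun s _ => g1 s) fun s _ v hv => ?_
      simp only [List.mem_cons, List.not_mem_nil, or_false] at hv
      rcases hv with rfl | rfl
      · exact ⟨_, g2 s⟩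
      · exact ⟨_, g3 s⟩
    have hV' := hV.extends hE hl (n' := n) fun i hi => .inr hi
    refine ⟨g '' V, hE, ⟨?_, ?_⟩, ?_⟩
    · rintro a ⟨_, ⟨s, hs, rfl⟩, hsa⟩
      have := (g2 s).symm.trans (hsa 0)
      simp only [Option.some.injEq] at this
      have haS : a 0 ∈ S := by
        rw [← this]
        split_ifs with hc
        · exact hc
        · exact hp
      obtain ⟨r, hr, hr'⟩ := hV'.fresh_surj _ haS
      exact ⟨r, hr, fun j => by rw [hr', Fin.fin_one_eq_zero j]⟩
    · change _ ∩ _ = ∅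
      rw [Set.eq_empty_iff_forall_notMem]
      rintro a ⟨⟨_, ⟨s, hs, rfl⟩, hsa⟩, ⟨r, hr, hra⟩⟩
      have := (g3 s).symm.trans (hsa 0)
      simp only [Option.some.injEq] at this
      have haS : a 0 ∉ S := by
        rw [← this]
        split_ifs with hc
        · exact hq
        · exact hc
      obtain ⟨c, hc, hc'⟩ := hV'.fresh_mem r hr
      have := (hra 0).symm.trans hc'
      simp only [Option.some.injEq] at this
      exact haS (this ▸ hc)
    · refine (isFlat_decides (isFlat_eq _ _) (isFlat_eq _ _) _).2 ?_
      rintro _ ⟨s, hs, rfl⟩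
      rw [hV'.one _ ⟨s, hs, rfl⟩, hV'.zero _ ⟨s, hs, rfl⟩, g1 s _ hb, g1 s _ (ha _),
        hV.apply_argVar hs, g2, g3, h s hs]
      by_cases hc : args n s i ∈ S
      · simp [bit_of_true, hc]
      · simp [bit_of_false, hc]

/-- Correctness of the translation of a relation variable. -/
theorem sat_relVar {S : Set B} {e₀ e₁ : B} (he : e₀ ≠ e₁)
    {n : ℕ} {V : Team B} (hV : IsCodeTeam arity S e₀ e₁ n V) (m : ℕ) (j : Fin k)
    (x : Fin (arity j) → Fin n) :
    (((eq (bitVar m) oneVar).or (eq (bitVar m) zeroVar)).and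
      (excl (Fin.cons (bitVar m) fun i => argVar (x i))
        (Fin.cons (negVar j) fun i => tupVar j i)) : DStarFormula L).Sat B V ↔
      ∀ s ∈ V, s (bitVar m) = some (bit e₀ e₁ (FirstOrder.Language.Structure.RelMap
        (relVars.symbol arity j) fun i => args n s (x i))) := by
  constructor
  · rintro ⟨h1, h2⟩ s hs
    have h1 := ((isFlat_eq _ _).or (isFlat_eq _ _) V).1 h1 s hs
    beta_reduce at h1
    rw [hV.one s hs, hV.zero s hs] at h1
    -- The member `t` stores the table entry of Xⱼ at the arguments of `s`.
    obtain ⟨t, ht, hta⟩ := hV.tup_surj j fun i => args n s (x i)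
    obtain ⟨a, ha, hb⟩ := hV.tup t ht j
    obtain rfl : a = fun i => args n s (x i) := by
      funext i
      exact Option.some.inj ((ha i).symm.trans (hta i))
    have key : ∀ c, s (bitVar m) = some c → t (negVar j) ≠ some c := by
      intro c hc hc'
      have : (Fin.cons c fun i => args n s (x i) : Fin (arity j + 1) → B) ∈
          (∅ : Set (Fin (arity j + 1) → B)) := by
        rw [← h2]
        refine ⟨⟨s, hs, fun i => ?_⟩, ⟨t, ht, fun i => ?_⟩⟩
        · refine Fin.cases ?_ (fun i => ?_) i
          · simpa using hc
          · simpa using hV.apply_argVar hs (x i)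
        · refine Fin.cases ?_ (fun i => ?_) i
          · simpa using hc'
          · simpa using ha i
      exact this
    rw [some_eq_bit_iff]
    refine h1.imp (fun h => ⟨h, ?_⟩) (fun h => ⟨h, fun h' => ?_⟩)
    · by_contra h'
      exact key _ h (by rw [hb, bit_of_true h'])
    · exact key _ h (by rw [hb, bit_of_false (not_not.2 h')])
  · intro h
    refine ⟨((isFlat_eq _ _).or (isFlat_eq _ _) V).2 fun s hs => ?_, ?_⟩
    · beta_reduce
      rw [hV.one s hs, hV.zero s hs]
      exact (some_eq_bit_iff.1 (h s hs)).imp And.left And.left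
    · change _ ∩ _ = ∅
      rw [Set.eq_empty_iff_forall_notMem]
      -- A common tuple would make the truth value at some arguments equal to its own negation.
      rintro c ⟨⟨s, hs, hsc⟩, ⟨t, ht, htc⟩⟩
      obtain ⟨a, ha, hb⟩ := hV.tup t ht j
      obtain rfl : a = fun i => args n s (x i) := by
        funext i
        have h1 := hsc i.succ
        have h2 := htc i.succ
        simp only [Fin.cons_succ] at h1 h2
        rw [ha] at h2
        rw [hV.apply_argVar hs] at h1
        exact Option.some.inj (h2.trans h1.symm)
      have h1 := hsc 0
      have h2 := htc 0
      simp only [Fin.cons_zero] at h1 h2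
      rw [h s hs] at h1
      rw [hb] at h2
      have h3 := Option.some.inj (h1.trans h2.symm)
      by_cases hR : FirstOrder.Language.Structure.RelMap
        (relVars.symbol arity j) fun i => args n s (x i)
      · rw [bit_of_true hR, bit_of_false (not_not.2 hR)] at h3
        exact he h3.symm
      · rw [bit_of_false hR, bit_of_true hR] at h3
        exact he h3

/-- The induction keeps `V` and `m` general, since subformulas are evaluated in extended teams with
other bit variables. From semantics to teams, the new bits are set to the true values; conversely,
the induction hypotheses make every chosen bit correct. -/
theorem sat_code [YLang.Structure B] {S : Set B} (hS : S.Nonempty) (hS' : Sᶜ.Nonempty)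
    (hY : ∀ a : Fin 1 → B, FirstOrder.Language.Structure.RelMap (L := YLang) YRel.Y a ↔ a 0 ∈ S)
    {e₀ e₁ : B} (he : e₀ ≠ e₁) {n : ℕ}
    (φ : ((L.sum YLang).sum (relVars arity)).BoundedFormula Empty n) (m : ℕ) {V : Team B}
    (hV : IsCodeTeam arity S e₀ e₁ n V) :
    (code φ m).Sat B V ↔
      ∀ s ∈ V, s (bitVar m) = some (bit e₀ e₁ (φ.Realize default (args n s))) := by
  induction φ generalizing m V with
  | falsum =>
    refine forall₂_congr fun s hs => ?_
    rw [hV.zero s hs, bit_of_false (P := FirstOrder.Language.BoundedFormula.Realize _ _ _) id]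
  | equal t₁ t₂ =>
    refine sat_decides hV (isFlat_eq _ _) (isFlat_neq _ _) (fun s hs => ?_) (fun s hs => ?_) <;>
      rw [hV.apply_argVar hs, hV.apply_argVar hs, FirstOrder.Language.BoundedFormula.Realize,
        realize_eq_termIndex, realize_eq_termIndex] <;> simp
  | @rel n l R ts =>
    have hr : (FirstOrder.Language.BoundedFormula.rel R ts).Realize (default : Empty → B) =
        fun xs => FirstOrder.Language.Structure.RelMap R fun i => xs (termIndex (ts i)) := by
      funext xs
      simp only [FirstOrder.Language.BoundedFormula.Realize, realize_eq_termIndex]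
    rw [hr]
    clear hr
    match l, R, ts with
    | l, .inl (.inl R), ts =>
      have key : ∀ s ∈ V, ∀ P : (Fin l → B) → Prop,
          (∃ a : Fin l → B, (∀ i, s (argVar (termIndex (ts i))) = some (a i)) ∧ P a) ↔
            P fun i => args n s (termIndex (ts i)) := by
        intro s hs P
        constructor
        · rintro ⟨a, ha, hP⟩
          convert hP with i
          exact Option.some.inj ((hV.apply_argVar hs _).symm.trans (ha i))
        · exact fun h => ⟨_, fun i => hV.apply_argVar hs _, h⟩
      exact sat_decides hV (isFlat_rel _ _) (isFlat_nrel _ _) (fun s hs => key s hs _)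
        (fun s hs => key s hs _)
    | _, .inl (.inr YRel.Y), ts =>
      refine (sat_fresh hS hS' hV m (termIndex (ts 0))).trans ?_
      refine forall₂_congr fun s hs => ?_
      rw [← hY fun i => args n s (termIndex (ts i))]
      rfl
    | _, .inr ⟨j, rfl⟩, ts =>
      exact sat_relVar he hV m j fun i => termIndex (ts i)
  | @imp n φ ψ ih1 ih2 =>
    have hl : ∀ v ∈ [bitVar (m + 1), bitVar (m + 2)], IsLocal v := by
      simp [isLocal_bitVar]
    have hb : bitVar m ∉ [bitVar (m + 1), bitVar (m + 2)] := by
      simp [bitVar_injective.eq_iff]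
    have ha : ∀ i, argVar i ∉ [bitVar (m + 1), bitVar (m + 2)] := by
      simp [argVar_ne_bitVar]
    have h12 : bitVar (m + 1) ≠ bitVar (m + 2) := by simp [bitVar_injective.eq_iff]
    have hflat := isFlat_decides (L := L) (B := B) (b := bitVar m)
      ((isFlat_eq (bitVar (m + 1)) zeroVar).or (isFlat_eq (bitVar (m + 2)) oneVar))
      ((isFlat_eq (bitVar (m + 1)) oneVar).and (isFlat_eq (bitVar (m + 2)) zeroVar))
    have key : ∀ {V' : Team B} {t}, IsCodeTeam arity S e₀ e₁ n V' → t ∈ V' →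
        t (bitVar (m + 1)) = some (bit e₀ e₁ (φ.Realize default (args n t))) →
        t (bitVar (m + 2)) = some (bit e₀ e₁ (ψ.Realize default (args n t))) →
        ((t (bitVar m) = t oneVar ∧ (t (bitVar (m + 1)) = t zeroVar ∨
          t (bitVar (m + 2)) = t oneVar) ∨ t (bitVar m) = t zeroVar ∧
            t (bitVar (m + 1)) = t oneVar ∧ t (bitVar (m + 2)) = t zeroVar) ↔
        t (bitVar m) = some (bit e₀ e₁ ((φ.imp ψ).Realize default (args n t)))) := by
      intro V' t hV' ht h1 h2
      rw [hV'.one t ht, hV'.zero t ht, h1, h2, some_eq_bit_iff,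
        FirstOrder.Language.BoundedFormula.realize_imp]
      by_cases hφ : φ.Realize default (args n t) <;> by_cases hψ : ψ.Realize default (args n t) <;>
        simp [hφ, hψ, bit_of_true, bit_of_false, he, he.symm]
    refine (sat_exMany _ _ V).trans ?_
    constructor
    · rintro ⟨V', hE, h1, h2, h3⟩ s hs
      have hV' := hV.extends hE hl (n' := n) fun i hi => .inr hi
      obtain ⟨t, ht, e, -⟩ := hE.2 s hs
      have h4 := (key hV' ht ((ih1 _ hV').1 h1 t ht) ((ih2 _ hV').1 h2 t ht)).1
        ((hflat V').1 h3 t ht)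
      rwa [e _ hb, args_congr fun i _ => e _ (ha i)] at h4
    · intro h
      let g : Assignment B → Assignment B := fun s =>
        (s.set (bitVar (m + 1)) (bit e₀ e₁ (φ.Realize default (args n s)))).set (bitVar (m + 2))
          (bit e₀ e₁ (ψ.Realize default (args n s)))
      have g1 : ∀ s, ∀ v ∉ [bitVar (m + 1), bitVar (m + 2)], g s v = s v := by
        intro s v hv
        simp only [List.mem_cons, List.not_mem_nil, or_false, not_or] at hv
        simp [g, Assignment.set, hv.1, hv.2]
      have g0 : ∀ s, args n (g s) = args n s := fun s => args_congr fun i _ => g1 s _ (ha i)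
      have g2 : ∀ s, g s (bitVar (m + 1)) =
          some (bit e₀ e₁ (φ.Realize default (args n (g s)))) := by
        intro s; rw [g0]; simp [g, Assignment.set, h12]
      have g3 : ∀ s, g s (bitVar (m + 2)) =
          some (bit e₀ e₁ (ψ.Realize default (args n (g s)))) := by
        intro s; rw [g0]; simp [g, Assignment.set]
      have hE : Team.Extends [bitVar (m + 1), bitVar (m + 2)] V (g '' V) := by
        refine Team.extends_image (fun s _ => g1 s) fun s _ v hv => ?_
        simp only [List.mem_cons, List.not_mem_nil, or_false] at hv
        rcases hv with rfl | rfl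
        · exact ⟨_, g2 s⟩
        · exact ⟨_, g3 s⟩
      have hV' := hV.extends hE hl (n' := n) fun i hi => .inr hi
      refine ⟨g '' V, hE, (ih1 _ hV').2 ?_, (ih2 _ hV').2 ?_, (hflat _).2 ?_⟩
      · rintro _ ⟨s, hs, rfl⟩
        exact g2 s
      · rintro _ ⟨s, hs, rfl⟩
        exact g3 s
      · rintro _ ⟨s, hs, rfl⟩
        refine (key hV' ⟨s, hs, rfl⟩ (g2 s) (g3 s)).2 ?_
        rw [g0, g1 s _ hb]
        exact h s hs
  | @all n φ ih =>
    have hb : ∀ l : List Var, (∀ v ∈ l, v = argVar n ∨ v = bitVar (m + 1)) → bitVar m ∉ l := by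
      intro l hl hm
      rcases hl _ hm with h | h
      · exact argVar_ne_bitVar _ _ h.symm
      · simp [bitVar_injective.eq_iff] at h
    have ha : ∀ l : List Var, (∀ v ∈ l, v = argVar n ∨ v = bitVar (m + 1)) →
        ∀ i < n, argVar i ∉ l := by
      intro l hl i hi hm
      rcases hl _ hm with h | h
      · exact hi.ne (argVar_injective h)
      · exact argVar_ne_bitVar _ _ h
    have hL : ∀ l : List Var, (∀ v ∈ l, v = argVar n ∨ v = bitVar (m + 1)) →
        ∀ v ∈ l, IsLocal v := by
      intro l hl v hv
      rcases hl _ hv with rfl | rfl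
      · exact isLocal_argVar _
      · exact isLocal_bitVar _
    have hl1 : ∀ v ∈ [argVar n], v = argVar n ∨ v = bitVar (m + 1) := by simp
    have hl2 : ∀ v ∈ [bitVar (m + 1)], v = argVar n ∨ v = bitVar (m + 1) := by simp
    have hl3 : ∀ v ∈ [argVar n, bitVar (m + 1)], v = argVar n ∨ v = bitVar (m + 1) := by simp
    have hab : argVar n ∉ [bitVar (m + 1)] := by simp [argVar_ne_bitVar]
    have hsucc : ∀ l : List Var, argVar n ∈ l → ∀ i < n + 1, argVar i ∈ l ∨ i < n := by
      intro l hl i hi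
      rcases Nat.lt_succ_iff_lt_or_eq.1 hi with h | rfl
      · exact .inr h
      · exact .inl hl
    have hflat₁ := (isFlat_eq (L := L) (B := B) (bitVar m) zeroVar).or
      ((isFlat_eq (bitVar m) oneVar).and (isFlat_eq (bitVar (m + 1)) oneVar))
    have hflat₂ := (isFlat_eq (L := L) (B := B) (bitVar m) oneVar).or
      ((isFlat_eq (bitVar m) zeroVar).and (isFlat_eq (bitVar (m + 1)) zeroVar))
    constructor
    · rintro ⟨h1, h2⟩ s hs
      rw [sat_allMany, sat_exMany] at h1
      rw [sat_exMany] at h2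
      obtain ⟨V₁, hE₁, h1, h1'⟩ := h1
      obtain ⟨V₂, hE₂, h2, h2'⟩ := h2
      have hF := Team.extends_full [argVar n] V
      have hW := hV.extends hF (hL _ hl1) (hsucc _ (by simp))
      have hV₁ := hW.extends hE₁ (hL _ hl2) (n' := n + 1) fun i hi => .inr hi
      have hV₂ := hV.extends hE₂ (hL _ hl3) (hsucc _ (by simp))
      -- Any extension of `s` will do: its inner bit is correct, so if the outer bit is 0, its value
      -- of `argVar n` is a counterexample.
      obtain ⟨t, ht, e, e'⟩ := hE₂.2 s hs
      obtain ⟨a, hta⟩ := e' (argVar n) (by simp)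
      have h5 := (hflat₂ V₂).1 h2' t ht
      beta_reduce at h5
      rw [(ih _ hV₂).1 h2 t ht, hV₂.one t ht, hV₂.zero t ht, e _ (hb _ hl3),
        args_succ (fun i hi => e _ (ha _ hl3 i hi)) hta] at h5
      rw [some_eq_bit_iff]
      rcases h5 with h5 | ⟨h5, h6⟩
      · refine .inl ⟨h5, fun a => ?_⟩
        have hr : s.set (argVar n) a ∈ V.full [argVar n] := by
          rw [← Team.duplicate_univ]
          exact ⟨s, hs, a, trivial, rfl⟩
        obtain ⟨t, ht, e, -⟩ := hE₁.2 _ hr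
        have hts : ∀ v ∉ [bitVar (m + 1)], v ≠ argVar n → t v = s v := by
          intro v hv hv'
          rw [e v hv]
          simp [Assignment.set, hv']
        have hta : t (argVar n) = some a := by
          rw [e _ hab]
          simp [Assignment.set]
        have h7 := (hflat₁ V₁).1 h1' t ht
        beta_reduce at h7
        rw [(ih _ hV₁).1 h1 t ht, hV₁.one t ht, hV₁.zero t ht,
          hts _ (hb _ hl2) (argVar_ne_bitVar _ _).symm, h5,
          args_succ (fun i hi => hts _ (ha _ hl2 i hi)
            (argVar_injective.ne hi.ne)) hta] at h7
        by_contra hφ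
        rw [bit_of_false hφ] at h7
        simp [he, he.symm] at h7
      · refine .inr ⟨h5, fun h => ?_⟩
        rw [bit_of_true (h a)] at h6
        exact he (Option.some.inj h6).symm
    · intro h
      constructor
      · rw [sat_allMany, sat_exMany]
        have hF := Team.extends_full [argVar n] V
        have hW := hV.extends hF (hL _ hl1) (hsucc _ (by simp))
        let g : Assignment B → Assignment B := fun r =>
          r.set (bitVar (m + 1)) (bit e₀ e₁ (φ.Realize default (args (n + 1) r)))
        have g1 : ∀ r, ∀ v ∉ [bitVar (m + 1)], g r v = r v := by
          intro r v hv
          simp only [List.mem_singleton] at hv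
          simp [g, Assignment.set, hv]
        have g2 : ∀ r, g r (bitVar (m + 1)) =
            some (bit e₀ e₁ (φ.Realize default (args (n + 1) r))) := by
          intro r; simp [g, Assignment.set]
        have hE : Team.Extends [bitVar (m + 1)] (V.full [argVar n]) (g '' V.full [argVar n]) := by
          refine Team.extends_image (fun r _ => g1 r) fun r _ v hv => ?_
          simp only [List.mem_singleton] at hv
          exact hv ▸ ⟨_, g2 r⟩
        have hV' := hW.extends hE (hL _ hl2) (n' := n + 1) fun i hi => .inr hi
        refine ⟨_, hE, (ih _ hV').2 ?_, (hflat₁ _).2 ?_⟩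
        · rintro _ ⟨r, hr, rfl⟩
          rw [g2, args_congr fun i _ => g1 r _ (by simp [argVar_ne_bitVar])]
        · rintro _ ⟨r, hr, rfl⟩
          rw [hV'.one _ ⟨r, hr, rfl⟩, hV'.zero _ ⟨r, hr, rfl⟩, g1 r _ (hb _ hl2), g2]
          obtain ⟨s, hs, e, e'⟩ := hr
          obtain ⟨a, hra⟩ := e' (argVar n) (by simp)
          rw [e _ (hb _ hl1), args_succ (fun i hi => e _ (ha _ hl1 i hi)) hra]
          rcases some_eq_bit_iff.1 (h s hs) with ⟨h1, h2⟩ | ⟨h1, h2⟩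
          · exact .inr ⟨h1, by rw [bit_of_true (h2 a)]⟩
          · exact .inl h1
      · rw [sat_exMany]
        -- A counterexample where the universal formula fails, and an arbitrary element elsewhere.
        have hw : ∀ s : Assignment B, ∃ a, ¬ φ.all.Realize default (args n s) →
            ¬ φ.Realize default (Fin.snoc (args n s) a : Fin (n + 1) → B) := by
          intro s
          by_cases hc : φ.all.Realize default (args n s)
          · exact ⟨Classical.arbitrary B, fun h => absurd hc h⟩
          · obtain ⟨a, ha⟩ := not_forall.1 hc
            exact ⟨a, fun _ => ha⟩
        choose w hw using hw
        let g : Assignment B → Assignment B := fun s =>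
          (s.set (argVar n) (w s)).set (bitVar (m + 1))
            (bit e₀ e₁ (φ.Realize default (Fin.snoc (args n s) (w s) : Fin (n + 1) → B)))
        have g1 : ∀ s, ∀ v ∉ [argVar n, bitVar (m + 1)], g s v = s v := by
          intro s v hv
          simp only [List.mem_cons, List.not_mem_nil, or_false, not_or] at hv
          simp [g, Assignment.set, hv.1, hv.2]
        have g2 : ∀ s, g s (bitVar (m + 1)) = some (bit e₀ e₁
            (φ.Realize default (Fin.snoc (args n s) (w s) : Fin (n + 1) → B))) := by
          intro s; simp [g, Assignment.set]
        have g3 : ∀ s, g s (argVar n) = some (w s) := by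
          intro s; simp [g, Assignment.set, argVar_ne_bitVar]
        have hE : Team.Extends [argVar n, bitVar (m + 1)] V (g '' V) := by
          refine Team.extends_image (fun s _ => g1 s) fun s _ v hv => ?_
          simp only [List.mem_cons, List.not_mem_nil, or_false] at hv
          rcases hv with rfl | rfl
          · exact ⟨_, g3 s⟩
          · exact ⟨_, g2 s⟩
        have hV' := hV.extends hE (hL _ hl3) (hsucc _ (by simp))
        refine ⟨_, hE, (ih _ hV').2 ?_, (hflat₂ _).2 ?_⟩
        · rintro _ ⟨s, hs, rfl⟩
          rw [g2, args_succ (fun i hi => g1 s _ (ha _ hl3 i hi)) (g3 s)]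
        · rintro _ ⟨s, hs, rfl⟩
          rw [hV'.one _ ⟨s, hs, rfl⟩, hV'.zero _ ⟨s, hs, rfl⟩, g1 s _ (hb _ hl3), g2]
          rcases some_eq_bit_iff.1 (h s hs) with ⟨h1, h2⟩ | ⟨h1, h2⟩
          · exact .inl h1
          · exact .inr ⟨h1, by rw [bit_of_false (hw s h2)]⟩

end DStarFormula

end Correctness

/-! ### The translation of sentences -/

namespace DStarFormula

theorem freeVars_foldr_and {ι : Type*} {L : FirstOrder.Language.{u, v}} (f : ι → DStarFormula L)
    (φ : DStarFormula L) (l : List ι) {v : Var}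
    (hv : v ∈ (l.foldr (fun j ψ => (f j).and ψ) φ).freeVars) :
    (∃ j ∈ l, v ∈ (f j).freeVars) ∨ v ∈ φ.freeVars := by
  induction l with
  | nil => exact .inr hv
  | cons j l ih =>
    rcases hv with hv | hv
    · exact .inl ⟨j, by simp, hv⟩
    · rcases ih hv with ⟨i, hi, h⟩ | h
      · exact .inl ⟨i, by simp [hi], h⟩
      · exact .inr h

end DStarFormula

section Translation

variable {L : FirstOrder.Language.{u, v}} [L.IsRelational] {k : ℕ}

/-- The universally quantified variables. -/
def tupVars (arity : Fin k → ℕ) : List ℕ :=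
  (List.finRange k).flatMap fun j => (List.finRange (arity j)).map fun i => tupVar j i

theorem mem_tupVars {arity : Fin k → ℕ} {v : ℕ} :
    v ∈ tupVars arity ↔ ∃ (j : Fin k) (i : Fin (arity j)), tupVar j i = v := by
  simp [tupVars]

/-- The existentially quantified variables. -/
def choiceVars (k : ℕ) : List ℕ :=
  zeroVar :: oneVar :: bitVar 0 :: (List.finRange k).map fun j => negVar j

theorem mem_choiceVars {v : ℕ} : v ∈ choiceVars k ↔
    v = zeroVar ∨ v = oneVar ∨ v = bitVar 0 ∨ ∃ j : Fin k, negVar j = v := by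
  simp [choiceVars]

theorem freshVar_notMem_tupVars (arity : Fin k → ℕ) : freshVar ∉ tupVars arity := by
  rw [mem_tupVars]
  rintro ⟨j, i, h⟩
  simp only [tupVar, freshVar] at h
  omega

theorem freshVar_notMem_choiceVars : freshVar ∉ choiceVars k := by
  rw [mem_choiceVars]
  simp only [freshVar, zeroVar, oneVar, bitVar, negVar]
  rintro (h | h | h | ⟨j, h⟩) <;> omega

theorem tupVar_notMem_choiceVars (j i : ℕ) : tupVar j i ∉ choiceVars k := by
  rw [mem_choiceVars]
  simp only [tupVar, zeroVar, oneVar, bitVar, negVar]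
  rintro (h | h | h | ⟨j, h⟩) <;> omega

theorem negVar_injective : Function.Injective negVar := fun i j h => by
  simp only [negVar] at h; omega

namespace DStarFormula

/-- The variables `negVar j` are truth values that depend on the arguments. -/
def relVarAtom (arity : Fin k → ℕ) (j : Fin k) : DStarFormula L :=
  (dep (fun i : Fin (arity j) => tupVar j i) (negVar j)).and
    ((eq (negVar j) oneVar).or (eq (negVar j) zeroVar))

/-- The part of the translation without the outer quantifiers. -/
def matrix {arity : Fin k → ℕ} (θ : ((L.sum YLang).sum (relVars arity)).Sentence) :
    DStarFormula L :=
  -- Dependence atoms with no determining variables make the two truth values constant across the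
  -- team.
  (((dep Fin.elim0 zeroVar).and (dep Fin.elim0 oneVar)).and (neq zeroVar oneVar)).and
    ((eq (bitVar 0) oneVar).and
      ((List.finRange k).foldr (fun j φ => (relVarAtom arity j).and φ) (code θ 0)))

/-- The translation of the sentence `∃X₁ … ∃Xₖ θ`, in the scope of a quantifier for `Y`. -/
def translate {arity : Fin k → ℕ} (θ : ((L.sum YLang).sum (relVars arity)).Sentence) :
    DStarFormula L :=
  allMany (tupVars arity) (exMany (choiceVars k) (matrix θ))

theorem sat_foldr_and {ι : Type*} {B : Type w} [L.Structure B] (f : ι → DStarFormula L)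
    (φ : DStarFormula L) (l : List ι) (V : Team B) :
    (l.foldr (fun j ψ => (f j).and ψ) φ).Sat B V ↔ (∀ j ∈ l, (f j).Sat B V) ∧ φ.Sat B V := by
  induction l with
  | nil => simp
  | cons j l ih =>
    change (f j).Sat B V ∧ (l.foldr (fun j ψ => (f j).and ψ) φ).Sat B V ↔ _
    rw [ih, List.forall_mem_cons, and_assoc]

theorem freeVars_matrix {arity : Fin k → ℕ} (θ : ((L.sum YLang).sum (relVars arity)).Sentence)
    {v : Var} (hv : v ∈ (matrix θ).freeVars) :
    v = freshVar ∨ v ∈ tupVars arity ∨ v ∈ choiceVars k := by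
  rw [mem_tupVars, mem_choiceVars]
  rcases hv with ((hv | hv) | hv) | hv | hv
  · rcases hv with rfl | ⟨i, -⟩
    · simp
    · exact i.elim0
  · rcases hv with rfl | ⟨i, -⟩
    · simp
    · exact i.elim0
  · rcases hv with rfl | rfl <;> simp
  · rcases hv with rfl | rfl <;> simp
  · rcases freeVars_foldr_and _ _ _ hv with ⟨j, -, hv⟩ | hv
    · have hn : ∃ j' : Fin k, negVar j' = negVar j := ⟨j, rfl⟩
      rcases hv with (rfl | ⟨i, rfl⟩) | (rfl | rfl) | (rfl | rfl)
      · exact .inr (.inr (.inr (.inr (.inr hn))))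
      · exact .inr (.inl ⟨j, i, rfl⟩)
      · exact .inr (.inr (.inr (.inr (.inr hn))))
      · simp
      · exact .inr (.inr (.inr (.inr (.inr hn))))
      · simp
    · rcases freeVars_code θ 0 hv with rfl | rfl | rfl | rfl | ⟨j, i, rfl⟩ | ⟨j, rfl⟩ | ⟨i, hi, -⟩
      · simp
      · simp
      · simp
      · simp
      · exact .inr (.inl ⟨j, i, rfl⟩)
      · exact .inr (.inr (.inr (.inr (.inr ⟨j, rfl⟩))))
      · exact absurd hi (Nat.not_lt_zero i)

theorem freeVars_bloat_translate {arity : Fin k → ℕ}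
    (θ : ((L.sum YLang).sum (relVars arity)).Sentence) :
    (bloat freshVar (translate θ)).freeVars = ∅ := by
  rw [Set.eq_empty_iff_forall_notMem]
  rintro v ⟨hv, hf⟩
  rw [translate, freeVars_allMany, freeVars_exMany] at hv
  rcases freeVars_matrix θ hv.1.1 with h | h | h
  · exact hf h
  · exact hv.2 h
  · exact hv.1.2 h

end DStarFormula

/-- The values of the fresh variable and of the tuples after the outer quantifiers. -/
theorem Team.Extends.outer {B : Type w} [Nonempty B] {arity : Fin k → ℕ} {S : Set B}
    (hS : S.Nonempty) {V V' : Team B} (hV : V = {s | ∃ a ∈ S, s = Assignment.empty.set freshVar a})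
    (hE : Team.Extends (choiceVars k) (V.full (tupVars arity)) V') :
    ((∀ t ∈ V', ∃ a ∈ S, t freshVar = some a) ∧ ∀ a ∈ S, ∃ t ∈ V', t freshVar = some a) ∧
      (∀ t ∈ V', ∀ j, ∃ a : Fin (arity j) → B, ∀ i : Fin (arity j), t (tupVar j i) = some (a i)) ∧
      ∀ j, ∀ a : Fin (arity j) → B, ∃ t ∈ V', ∀ i : Fin (arity j), t (tupVar j i) = some (a i) := by
  classical
  subst hV
  have hf := freshVar_notMem_tupVars arity
  have hf' := freshVar_notMem_choiceVars (k := k)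
  refine ⟨⟨fun t ht => ?_, fun a ha => ?_⟩, fun t ht j => ?_, fun j a => ?_⟩
  · obtain ⟨r, ⟨_, ⟨a, ha, rfl⟩, h1, -⟩, h2, -⟩ := hE.1 t ht
    exact ⟨a, ha, by rw [h2 _ hf', h1 _ hf]; simp [Assignment.set]⟩
  · obtain ⟨r, hr, h1, -⟩ := (Team.extends_full (tupVars arity)
      {s | ∃ a ∈ S, s = Assignment.empty.set freshVar a}).2 _ ⟨a, ha, rfl⟩
    obtain ⟨t, ht, h2, -⟩ := hE.2 r hr
    exact ⟨t, ht, by rw [h2 _ hf', h1 _ hf]; simp [Assignment.set]⟩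
  · obtain ⟨r, ⟨_, ⟨a, ha, rfl⟩, -, h1⟩, h2, -⟩ := hE.1 t ht
    have : ∀ i : Fin (arity j), ∃ a, t (tupVar j i) = some a := by
      intro i
      rw [h2 _ (tupVar_notMem_choiceVars _ _)]
      exact h1 _ (mem_tupVars.2 ⟨j, i, rfl⟩)
    choose a ha using this
    exact ⟨a, ha⟩
  · obtain ⟨c, hc⟩ := hS
    -- The j-th tuple is set to `a`, all other tuple variables to `c`; injectivity of `tupVar`
    -- identifies the chosen index.
    let r : Assignment B := fun v =>
      if v ∈ tupVars arity then
        if h : ∃ i : Fin (arity j), tupVar j i = v then some (a h.choose) else some c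
      else (Assignment.empty.set freshVar c : Assignment B) v
    have hr : ∀ i : Fin (arity j), r (tupVar j i) = some (a i) := by
      intro i
      have h : ∃ i' : Fin (arity j), tupVar j i' = tupVar j i := ⟨i, rfl⟩
      have h' : h.choose = i := Fin.ext (tupVar_inj.1 h.choose_spec).2
      have hm : tupVar j i ∈ tupVars arity := mem_tupVars.2 ⟨j, i, rfl⟩
      simp only [r, if_pos hm, dif_pos h, h']
    have hrV : r ∈ Team.full (tupVars arity) {s | ∃ a ∈ S, s = Assignment.empty.set freshVar a} := by
      refine ⟨_, ⟨c, hc, rfl⟩, fun v hv => if_neg hv, fun v hv => ?_⟩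
      simp only [r, if_pos hv]
      split_ifs <;> exact ⟨_, rfl⟩
    obtain ⟨t, ht, h2, -⟩ := hE.2 r hrV
    exact ⟨t, ht, fun i => by rw [h2 _ (tupVar_notMem_choiceVars _ _), hr]⟩

/-- From a team the relations are read off the tables, consistently because of the dependence atoms;
from relations the tables are filled in. -/
theorem DStarFormula.sat_translate {B : Type w} [Nonempty B] [L.Structure B] [YLang.Structure B]
    {S : Set B} (hS : S.Nonempty) (hS' : Sᶜ.Nonempty)
    (hY : ∀ a : Fin 1 → B, FirstOrder.Language.Structure.RelMap (L := YLang) YRel.Y a ↔ a 0 ∈ S)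
    (φ : ESOSentence (L.sum YLang)) {V : Team B}
    (hV : V = {s | ∃ a ∈ S, s = Assignment.empty.set freshVar a}) :
    (translate φ.body).Sat B V ↔ φ.Realize B := by
  classical
  rw [translate, sat_allMany, sat_exMany]
  constructor
  · rintro ⟨V', hE, ⟨⟨h0, h1⟩, h01⟩, hb, hr⟩
    rw [sat_foldr_and] at hr
    obtain ⟨hr, hθ⟩ := hr
    obtain ⟨⟨hf, hf'⟩, ht, ht'⟩ := hE.outer hS hV
    obtain ⟨c, hc⟩ := id hS
    obtain ⟨r, hrV, -⟩ := hf' c hc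
    obtain ⟨-, -, -, hd⟩ := hE.1 r hrV
    obtain ⟨e₀, he₀⟩ := hd zeroVar (mem_choiceVars.2 (.inl rfl))
    obtain ⟨e₁, he₁⟩ := hd oneVar (mem_choiceVars.2 (.inr (.inl rfl)))
    have hz : ∀ s ∈ V', s zeroVar = some e₀ := fun s hs =>
      (h0 s hs r hrV fun i => i.elim0).trans he₀
    have ho : ∀ s ∈ V', s oneVar = some e₁ := fun s hs =>
      (h1 s hs r hrV fun i => i.elim0).trans he₁
    have he : e₀ ≠ e₁ := by
      rintro rfl
      exact h01 r hrV (he₀.trans he₁.symm)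
    -- The tables store complements, so a tuple belongs to Xⱼ when its entry is the false value
    -- `e₀`.
    let X : (j : Fin φ.k) → Set (Fin (φ.arity j) → B) := fun j =>
      {a | ∃ s ∈ V', (∀ i : Fin (φ.arity j), s (tupVar j i) = some (a i)) ∧
        s (negVar j) = some e₀}
    let _ : (relVars φ.arity).Structure B := relVars.structure X
    have hC : IsCodeTeam φ.arity S e₀ e₁ 0 V' := by
      refine ⟨hf, hf', hz, ho, fun s hs j => ?_, ht', fun s hs i hi => absurd hi (Nat.not_lt_zero i)⟩
      obtain ⟨a, ha⟩ := ht s hs j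
      refine ⟨a, ha, ?_⟩
      obtain ⟨hdep, hbit⟩ := hr j (List.mem_finRange j)
      have hbit := ((isFlat_eq _ _).or (isFlat_eq _ _) V').1 hbit s hs
      beta_reduce at hbit
      rw [hz s hs, ho s hs] at hbit
      rw [some_eq_bit_iff]
      change _ ∧ ¬ a ∈ X j ∨ _ ∧ ¬ ¬ a ∈ X j
      refine hbit.imp (fun h => ⟨h, ?_⟩) fun h => ⟨h, not_not.2 ⟨s, hs, ha, h⟩⟩
      -- Another member with the same tuple cannot carry the other entry, by the dependence atom.
      rintro ⟨t, ht, hta, htn⟩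
      have := hdep s hs t ht fun i => (ha i).trans (hta i).symm
      rw [h, htn] at this
      exact he (Option.some.inj this).symm
    refine ⟨X, ?_⟩
    have h := (sat_code hS hS' hY he φ.body 0 hC).1 hθ r hrV
    rw [hb r hrV, he₁] at h
    by_contra hn
    have hn' : ¬ FirstOrder.Language.BoundedFormula.Realize φ.body default (args 0 r) := by
      rwa [Subsingleton.elim (args 0 r) default]
    rw [bit_of_false hn'] at h
    exact he (Option.some.inj h).symm
  · rintro ⟨X, hX⟩
    let _ : (relVars φ.arity).Structure B := relVars.structure X
    -- A fresh and an old element serve as the truth values, hence they are distinct.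
    obtain ⟨e₀, he₀⟩ := id hS
    obtain ⟨e₁, he₁⟩ := id hS'
    have he : e₀ ≠ e₁ := by
      rintro rfl
      exact he₁ he₀
    let val : Assignment B → Fin φ.k → B := fun s j =>
      bit e₀ e₁ (¬ FirstOrder.Language.Structure.RelMap (relVars.symbol φ.arity j)
        fun i => (s (tupVar j i)).getD e₀)
    let g : Assignment B → Assignment B := fun s v =>
      if v = zeroVar then some e₀ else if v = oneVar then some e₁ else
        if v = bitVar 0 then some e₁ else
          if h : ∃ j : Fin φ.k, negVar j = v then some (val s h.choose) else s v
    have g1 : ∀ s, ∀ v ∉ choiceVars φ.k, g s v = s v := by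
      intro s v hv
      rw [mem_choiceVars] at hv
      simp only [not_or] at hv
      simp only [g, if_neg hv.1, if_neg hv.2.1, if_neg hv.2.2.1, dif_neg hv.2.2.2]
    have g2 : ∀ s, g s zeroVar = some e₀ := fun s => if_pos rfl
    have g3 : ∀ s, g s oneVar = some e₁ := fun s => by simp [g, zeroVar, oneVar]
    have g4 : ∀ s, g s (bitVar 0) = some e₁ := fun s => by simp [g, zeroVar, oneVar, bitVar]
    have g5 : ∀ s (j : Fin φ.k), g s (negVar j) = some (val s j) := by
      intro s j
      have h : ∃ j' : Fin φ.k, negVar j' = negVar j := ⟨j, rfl⟩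
      have h' : h.choose = j := Fin.ext (negVar_injective h.choose_spec)
      have n1 : negVar j ≠ zeroVar := by simp only [negVar, zeroVar]; omega
      have n2 : negVar j ≠ oneVar := by simp only [negVar, oneVar]; omega
      have n3 : negVar j ≠ bitVar 0 := by simp only [negVar, bitVar]; omega
      simp only [g, if_neg n1, if_neg n2, if_neg n3, dif_pos h, h']
    have hE : Team.Extends (choiceVars φ.k) (V.full (tupVars φ.arity))
        (g '' V.full (tupVars φ.arity)) := by
      refine Team.extends_image (fun s _ => g1 s) fun s _ v hv => ?_
      rcases mem_choiceVars.1 hv with rfl | rfl | rfl | ⟨j, rfl⟩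
      · exact ⟨_, g2 s⟩
      · exact ⟨_, g3 s⟩
      · exact ⟨_, g4 s⟩
      · exact ⟨_, g5 s j⟩
    obtain ⟨⟨hf, hf'⟩, ht, ht'⟩ := hE.outer hS hV
    have hneg : ∀ s ∈ V.full (tupVars φ.arity), ∀ j, ∀ a : Fin (φ.arity j) → B,
        (∀ i : Fin (φ.arity j), g s (tupVar j i) = some (a i)) → g s (negVar j) =
          some (bit e₀ e₁ (¬ FirstOrder.Language.Structure.RelMap (relVars.symbol φ.arity j) a)) := by
      intro s hs j a ha
      rw [g5]
      simp only [val]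
      congr 4
      funext i
      rw [← g1 s _ (tupVar_notMem_choiceVars _ _), ha]
      rfl
    have hC : IsCodeTeam φ.arity S e₀ e₁ 0 (g '' V.full (tupVars φ.arity)) := by
      refine ⟨hf, hf', ?_, ?_, ?_, ht', fun s hs i hi => absurd hi (Nat.not_lt_zero i)⟩
      · rintro _ ⟨s, hs, rfl⟩
        exact g2 s
      · rintro _ ⟨s, hs, rfl⟩
        exact g3 s
      · rintro _ ⟨s, hs, rfl⟩ j
        obtain ⟨a, ha⟩ := ht _ ⟨s, hs, rfl⟩ j
        exact ⟨a, ha, hneg s hs j a ha⟩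
    refine ⟨_, hE, ⟨⟨?_, ?_⟩, ?_⟩, ?_, ?_⟩
    · rintro _ ⟨s, hs, rfl⟩ _ ⟨t, ht, rfl⟩ -
      rw [g2, g2]
    · rintro _ ⟨s, hs, rfl⟩ _ ⟨t, ht, rfl⟩ -
      rw [g3, g3]
    · rintro _ ⟨s, hs, rfl⟩
      rw [g2, g3]
      exact fun h => he (Option.some.inj h)
    · rintro _ ⟨s, hs, rfl⟩
      rw [g3, g4]
    · rw [sat_foldr_and]
      refine ⟨fun j _ => ⟨?_, ((isFlat_eq _ _).or (isFlat_eq _ _) _).2 ?_⟩,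
        (sat_code hS hS' hY he φ.body 0 hC).2 ?_⟩
      · rintro _ ⟨s, hs, rfl⟩ _ ⟨t, ht', rfl⟩ h
        obtain ⟨a, ha⟩ := ht _ ⟨s, hs, rfl⟩ j
        rw [hneg s hs j a ha, hneg t ht' j a fun i => (h i).symm.trans (ha i)]
      · rintro _ ⟨s, hs, rfl⟩
        rw [g2, g3, g5]
        exact ((some_eq_bit_iff).1 rfl).imp And.left And.left
      · rintro _ ⟨s, hs, rfl⟩
        rw [g4, bit_of_true]
        rwa [Subsingleton.elim (args 0 (g s)) default]

end Translation

end TeamLogic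

theorem mainTheorem2 (L : FirstOrder.Language.{u, v}) [L.IsRelational]
    (φ : TeamLogic.LRESentence L) :
    ∃ ψ : TeamLogic.DStarSentence L, ∀ (A : Type w) [L.Structure A] [Nonempty A],
      φ.Realize A ↔ ψ.Realize A := by
  refine ⟨⟨_, TeamLogic.DStarFormula.freeVars_bloat_translate φ.body.body⟩, fun A _ hA => ?_⟩
  refine exists_congr fun S => and_congr_right fun _ => and_congr_right fun hS => ?_
  have : Nonempty (TeamLogic.Bloat A S) := hA.map TeamLogic.Bloat.old
  refine (TeamLogic.DStarFormula.sat_translate (S := TeamLogic.Bloat.fresh A S)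
    (Set.range_nonempty _) ?_ (fun a => Iff.rfl) φ.body ?_).symm
  -- An old element witnesses that S is not the whole bloated domain.
  · obtain ⟨a⟩ := hA
    refine ⟨TeamLogic.Bloat.old a, ?_⟩
    rintro ⟨b, hb⟩
    exact Sum.inr_ne_inl hb
  · rw [Set.image_singleton]
    ext s
    simp only [TeamLogic.Team.duplicate, Set.mem_singleton_iff, exists_eq_left]
    rfl
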